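/- Let $H\in(0,1)$ and let $X=(X_t)_{t\in\mathbf R}$ be a standard fractional Brownian motion with Hurst index $H$ on a probability space, i.e. a centred real Gaussian process with stationary increments and $\mathbf E X_t^2=|t|^{2H}$. Write $\widehat f(\xi)=(2\pi)^{-1/2}\int_{\mathbf R}e^{-ix\xi}f(x)\,dx$ for the Fourier transform (extended to tempered distributions). For $|s|<\tfrac12$ let $\widetilde W^{s,2}(\mathbf R)$ be the homogeneous Sobolev space of real-valued tempered distributions $f$ whose Fourier transform is a locally integrable function with $\int_{\mathbf R}|\widehat f(\xi)|^2|\xi|^{2s}\,d\xi<\infty$, with inner product $$(f,g)_{\widetilde W^{s,2}}=\int_{\mathbf R}\widehat f(\xi)\overline{\widehat g(\xi)}\,|\xi|^{2s}\,d\xi ,$$ and for an open interval $I\subset\mathbf R$, bounded or not, let $\widetilde W^{s,2}_0(I)$ be the closure in $\widetilde W^{s,2}(\mathbf R)$ of the set $C_0^\infty(I)$ of real-valued test functions compactly supported in $I$. Let $E_I\subset L^2(\mathbf P)$ be the closed real linear span of the increments $X_u-X_v$, $u,v\in I$. For $\phi\in C_0^\infty(\mathbf R)$ let $\int_{\mathbf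 R}\phi'(t)X_t\,dt$ be the $L^2(\mathbf P)$-valued Bochner integral. Put $a_H:=\sin(\pi H)\,\Gamma(1+2H)$. Then $a_H>0$, and for all real-valued $\phi_1,\phi_2\in C_0^\infty(\mathbf R)$ $$\mathbf E\Big[\Big(\int_{\mathbf R}\phi_1'(t)X_t\,dt\Big)\Big(\int_{\mathbf R}\phi_2'(t)X_t\,dt\Big)\Big]=a_H\,(\phi_1,\phi_2)_{\widetilde W^{1/2-H,2}} .$$ Moreover there is a bijective linear isometry $J:E_{(-\infty,\infty)}\to\widetilde W^{1/2-H,2}(\mathbf R)$ such that $J\big(\int_{\mathbf R}\phi'(t)X_t\,dt\big)=\sqrt{a_H}\,\phi$ for every real-valued $\phi\in C_0^\infty(\mathbf R)$ (in particular $\int_{\mathbf R}\phi'(t)X_t\,dt\in E_{(-\infty,\infty)}$), and $J(E_I)=\widetilde W^{1/2-H,2}_0(I)$ for every open interval $I\subset\mathbf R$. -/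

import Mathlib

open MeasureTheory ProbabilityTheory TopologicalSpace
open scoped SchwartzMap Distributions FourierTransform ENNReal

noncomputable section

/-! ### The unitary Fourier transform -/

/-- The dilation `ξ ↦ ξ / (2π)` of the line. -/
def frequencyScale : ℝ ≃L[ℝ] ℝ :=
  ContinuousLinearEquiv.unitsEquivAut ℝ (Units.mk0 ((2 * Real.pi)⁻¹) (by positivity))

/-- The unitary Fourier transform `ψ̂(ξ) = (2π)^(-1/2) ∫ e^(-ixξ) ψ(x) dx` on Schwartz functions
(see `unitaryFourier_apply`); Mathlib's `𝓕` uses the kernel `e^(-2πixξ)` instead. -/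
def unitaryFourier : 𝓢(ℝ, ℂ) →L[ℂ] 𝓢(ℝ, ℂ) :=
  (((√(2 * Real.pi))⁻¹ : ℝ) : ℂ) •
    ((SchwartzMap.compCLMOfContinuousLinearEquiv ℂ frequencyScale).comp
      (FourierTransform.fourierCLM ℂ 𝓢(ℝ, ℂ)))

theorem unitaryFourier_eq (ψ : 𝓢(ℝ, ℂ)) (ξ : ℝ) :
    unitaryFourier ψ ξ = (((√(2 * Real.pi))⁻¹ : ℝ) : ℂ) * 𝓕 ψ (ξ * (2 * Real.pi)⁻¹) := rfl

theorem unitaryFourier_apply (ψ : 𝓢(ℝ, ℂ)) (ξ : ℝ) :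
    unitaryFourier ψ ξ = (((√(2 * Real.pi))⁻¹ : ℝ) : ℂ) *
      ∫ x : ℝ, Complex.exp (-(Complex.I * x * ξ)) * ψ x := by
  rw [unitaryFourier_eq, SchwartzMap.fourier_coe, Real.fourier_real_eq_integral_exp_smul]
  congr 2
  ext x
  rw [smul_eq_mul]
  congr 2
  push_cast
  have : (Real.pi : ℂ) ≠ 0 := by exact_mod_cast Real.pi_ne_zero
  field_simp

theorem unitaryFourier_surjective : Function.Surjective unitaryFourier := by
  intro χ
  have hc : (((√(2 * Real.pi))⁻¹ : ℝ) : ℂ) ≠ 0 := by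
    have : (√(2 * Real.pi))⁻¹ ≠ 0 := by positivity
    exact_mod_cast this
  refine ⟨𝓕⁻ ((((√(2 * Real.pi))⁻¹ : ℝ) : ℂ)⁻¹ •
    SchwartzMap.compCLMOfContinuousLinearEquiv ℂ frequencyScale.symm χ), ?_⟩
  ext ξ
  have h2 : frequencyScale.symm (ξ * (2 * Real.pi)⁻¹) = ξ :=
    frequencyScale.symm_apply_apply ξ
  rw [unitaryFourier_eq, FourierTransform.fourier_fourierInv_eq, smul_apply,
    SchwartzMap.compCLMOfContinuousLinearEquiv_apply, Function.comp_apply, h2, smul_eq_mul,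
    mul_inv_cancel_left₀ hc]

/-- `∫ φ ψ̂ = ∫ ψ φ̂` for Schwartz functions. -/
theorem integral_unitaryFourier_mul_eq (φ ψ : 𝓢(ℝ, ℂ)) :
    ∫ x, unitaryFourier ψ x * φ x = ∫ ξ, ψ ξ * unitaryFourier φ ξ := by
  have hpi : (0 : ℝ) < 2 * Real.pi := by positivity
  let φ' : 𝓢(ℝ, ℂ) := SchwartzMap.compCLMOfContinuousLinearEquiv ℂ frequencyScale.symm φ
  have hφ' : ∀ x, φ' (x * (2 * Real.pi)⁻¹) = φ x := fun x =>
    congrArg φ (frequencyScale.symm_apply_apply x)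
  have hF : ∀ ξ : ℝ, 𝓕 φ' ξ = ((2 * Real.pi : ℝ)⁻¹ : ℝ) * 𝓕 φ (ξ * (2 * Real.pi)⁻¹) := by
    intro ξ
    rw [SchwartzMap.fourier_coe, SchwartzMap.fourier_coe, Real.fourier_real_eq_integral_exp_smul,
      Real.fourier_real_eq_integral_exp_smul]
    have key := Measure.integral_comp_mul_right
      (fun v : ℝ => Complex.exp (((-2 * Real.pi * v * ξ : ℝ) : ℂ) * Complex.I) • φ' v)
      ((2 * Real.pi)⁻¹)
    rw [inv_inv, abs_of_pos hpi] at key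
    have : (∫ v : ℝ, Complex.exp (((-2 * Real.pi * v * ξ : ℝ) : ℂ) * Complex.I) • φ' v)
        = (2 * Real.pi)⁻¹ • ∫ x : ℝ, Complex.exp
            (((-2 * Real.pi * (x * (2 * Real.pi)⁻¹) * ξ : ℝ) : ℂ) * Complex.I) •
              φ' (x * (2 * Real.pi)⁻¹) := by
      rw [key, inv_smul_smul₀ hpi.ne']
    rw [this, Complex.real_smul]
    congr 2
    ext x
    rw [hφ']
    congr 4
    ring
  have key := SchwartzMap.integral_fourier_mul_eq ψ φ'
  have h1 := Measure.integral_comp_mul_right (fun v : ℝ => 𝓕 ψ v * φ' v) ((2 * Real.pi)⁻¹)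
  rw [inv_inv, abs_of_pos hpi] at h1
  simp only [hφ'] at h1
  simp only [unitaryFourier_eq]
  simp only [hF] at key
  simp_rw [mul_assoc, mul_left_comm (ψ _)]
  rw [integral_const_mul, integral_const_mul, h1, key]
  congr 1
  simp_rw [mul_left_comm (ψ _)]
  rw [integral_const_mul, Complex.real_smul, ← mul_assoc, ← Complex.ofReal_mul,
    mul_inv_cancel₀ hpi.ne', Complex.ofReal_one, one_mul]

/-! ### Homogeneous Sobolev spaces of real-valued distributions on the line -/

/-- The weighted measure `|ξ|^(2s) dξ`. -/
def homWeight (s : ℝ) : Measure ℝ :=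
  volume.withDensity fun ξ => ENNReal.ofReal (|ξ| ^ (2 * s))

theorem homWeight_ac (s : ℝ) : homWeight s ≪ volume := withDensity_absolutelyContinuous _ _

theorem ac_homWeight (s : ℝ) : volume ≪ homWeight s := by
  refine withDensity_absolutelyContinuous' (by fun_prop) ?_
  have : ∀ᵐ x : ℝ, x ≠ 0 := by simp [ae_iff]
  filter_upwards [this] with x hx
  have : 0 < |x| ^ (2 * s) := Real.rpow_pos_of_pos (abs_pos.2 hx) _
  simpa using this

/-- The tempered distribution `f` has as its (distributional) Fourier transform, defined by
`f̂(ψ) = f(ψ̂)`, the locally integrable function `g`. -/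
def HasFourierDensity (f : 𝓢'(ℝ, ℂ)) (g : ℝ → ℂ) : Prop :=
  LocallyIntegrable g ∧
    ∀ ψ : 𝓢(ℝ, ℂ), Integrable (fun ξ => ψ ξ * g ξ) ∧ f (unitaryFourier ψ) = ∫ ξ, ψ ξ * g ξ

theorem HasFourierDensity.ae_eq {f : 𝓢'(ℝ, ℂ)} {g g' : ℝ → ℂ} (h : HasFourierDensity f g)
    (h' : HasFourierDensity f g') : g =ᵐ[volume] g' := by
  refine ae_eq_of_integral_contDiff_smul_eq h.1 h'.1 fun u hu hc => ?_
  have hc' : HasCompactSupport (fun x => (u x : ℂ)) := hc.comp_left Complex.ofReal_zero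
  have hu' : ContDiff ℝ (⊤ : ℕ∞) (fun x => (u x : ℂ)) := Complex.ofRealCLM.contDiff.comp hu
  have h1 := (h.2 (hc'.toSchwartzMap hu')).2.symm.trans (h'.2 (hc'.toSchwartzMap hu')).2
  simpa using h1

theorem HasFourierDensity.add {f f' : 𝓢'(ℝ, ℂ)} {g g' : ℝ → ℂ} (h : HasFourierDensity f g)
    (h' : HasFourierDensity f' g') : HasFourierDensity (f + f') (g + g') := by
  refine ⟨h.1.add h'.1, fun ψ => ⟨?_, ?_⟩⟩
  · refine ((h.2 ψ).1.add (h'.2 ψ).1).congr (Filter.Eventually.of_forall fun ξ => ?_)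
    simp [mul_add]
  · have : (f + f') (unitaryFourier ψ) = f (unitaryFourier ψ) + f' (unitaryFourier ψ) := rfl
    rw [this, (h.2 ψ).2, (h'.2 ψ).2,
      ← integral_add (h.2 ψ).1 (h'.2 ψ).1]
    simp [mul_add]

theorem HasFourierDensity.smul {f : 𝓢'(ℝ, ℂ)} {g : ℝ → ℂ} (c : ℝ) (h : HasFourierDensity f g) :
    HasFourierDensity (c • f) (c • g) := by
  refine ⟨h.1.smul c, fun ψ => ⟨?_, ?_⟩⟩
  · simpa [mul_left_comm] using (h.2 ψ).1.const_mul (c : ℂ)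
  · have : (c • f) (unitaryFourier ψ) = c • f (unitaryFourier ψ) := rfl
    rw [this, (h.2 ψ).2, ← integral_smul]
    simp [mul_left_comm]

theorem HasFourierDensity.zero : HasFourierDensity 0 0 :=
  ⟨locallyIntegrable_zero, fun ψ => by simp⟩

/-- A tempered distribution is real-valued if it is real on real-valued Schwartz functions. -/
def IsRealDistribution (f : 𝓢'(ℝ, ℂ)) : Prop :=
  ∀ ψ : 𝓢(ℝ, ℂ), (∀ x, (ψ x).im = 0) → (f ψ).im = 0

/-- The real-valued tempered distributions whose Fourier transform is a locally integrable function
in `L²(|ξ|^(2s) dξ)`. -/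
def homSobolevSubmodule (s : ℝ) : Submodule ℝ 𝓢'(ℝ, ℂ) where
  carrier := {f | IsRealDistribution f ∧ ∃ g, HasFourierDensity f g ∧ MemLp g 2 (homWeight s)}
  add_mem' := by
    rintro f f' ⟨hf, g, hg, hg2⟩ ⟨hf', g', hg', hg2'⟩
    refine ⟨fun ψ hψ => ?_, g + g', hg.add hg', hg2.add hg2'⟩
    simp [hf ψ hψ, hf' ψ hψ]
  zero_mem' := ⟨fun ψ _ => by simp, 0, .zero, MemLp.zero⟩
  smul_mem' := by
    rintro c f ⟨hf, g, hg, hg2⟩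
    refine ⟨fun ψ hψ => ?_, c • g, hg.smul c, hg2.const_smul c⟩
    have : (c • f) ψ = c • f ψ := rfl
    simp [this, hf ψ hψ]

/-- The homogeneous Sobolev space `W̃^(s,2)(ℝ)`, `|s| < 1/2`, of real-valued distributions. It is a
type of its own because it carries the norm `(∫ |f̂(ξ)|² |ξ|^(2s) dξ)^(1/2)` below and not the
topology of tempered distributions. -/
def HomSobolev (s : ℝ) : Type := ↥(homSobolevSubmodule s)

namespace HomSobolev

variable {s : ℝ}

instance : AddCommGroup (HomSobolev s) := inferInstanceAs (AddCommGroup ↥(homSobolevSubmodule s))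

instance : Module ℝ (HomSobolev s) := inferInstanceAs (Module ℝ ↥(homSobolevSubmodule s))

/-- The underlying tempered distribution. -/
def toDistribution : HomSobolev s →ₗ[ℝ] 𝓢'(ℝ, ℂ) := (homSobolevSubmodule s).subtype

theorem toDistribution_injective : Function.Injective (toDistribution (s := s)) :=
  Subtype.val_injective

theorem exists_density (f : HomSobolev s) :
    ∃ g, HasFourierDensity (toDistribution f) g ∧ MemLp g 2 (homWeight s) := f.2.2

/-- The Fourier transform of `f`, as an element of `L²(|ξ|^(2s) dξ)`. -/
def fourierLp (f : HomSobolev s) : Lp ℂ 2 (homWeight s) :=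
  f.exists_density.choose_spec.2.toLp

theorem fourierLp_eq (f : HomSobolev s) {g : ℝ → ℂ} (hg : HasFourierDensity (toDistribution f) g)
    (hg2 : MemLp g 2 (homWeight s)) : fourierLp f = hg2.toLp := by
  rw [fourierLp, MemLp.toLp_eq_toLp_iff]
  exact (homWeight_ac s).ae_eq (f.exists_density.choose_spec.1.ae_eq hg)

/-- The Fourier transform `f ↦ f̂` as a linear map into `L²(|ξ|^(2s) dξ)`. -/
def fourierLin (s : ℝ) : HomSobolev s →ₗ[ℝ] Lp ℂ 2 (homWeight s) where
  toFun := fourierLp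
  map_add' f f' := by
    obtain ⟨g, hg, hg2⟩ := f.exists_density
    obtain ⟨g', hg', hg2'⟩ := f'.exists_density
    rw [f.fourierLp_eq hg hg2, f'.fourierLp_eq hg' hg2', ← MemLp.toLp_add]
    exact (f + f').fourierLp_eq (by rw [map_add]; exact hg.add hg') (hg2.add hg2')
  map_smul' c f := by
    obtain ⟨g, hg, hg2⟩ := f.exists_density
    rw [f.fourierLp_eq hg hg2, RingHom.id_apply, ← MemLp.toLp_const_smul]
    exact (c • f).fourierLp_eq (by rw [map_smul]; exact hg.smul c) (hg2.const_smul c)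

theorem fourierLin_injective (s : ℝ) : Function.Injective (fourierLin s) := by
  refine (injective_iff_map_eq_zero (fourierLin s)).2 fun f hf => ?_
  obtain ⟨g, hg, hg2⟩ := f.exists_density
  have h0 : hg2.toLp = 0 := (f.fourierLp_eq hg hg2).symm.trans hf
  have h1 : g =ᵐ[homWeight s] 0 := hg2.coeFn_toLp.symm.trans ((Lp.eq_zero_iff_ae_eq_zero).1 h0)
  have h2 : g =ᵐ[volume] 0 := (ac_homWeight s).ae_eq h1
  apply toDistribution_injective
  rw [map_zero]
  ext χ
  obtain ⟨ψ, rfl⟩ := unitaryFourier_surjective χ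
  rw [(hg.2 ψ).2, integral_eq_zero_of_ae]
  · rfl
  · filter_upwards [h2] with ξ hξ
    simp [hξ]

/-- The norm is `‖f‖ = (∫ |f̂(ξ)|² |ξ|^(2s) dξ)^(1/2)`. -/
instance : NormedAddCommGroup (HomSobolev s) :=
  NormedAddCommGroup.induced _ _ (fourierLin s) (fourierLin_injective s)

/-- The inner product is `(f, h) = ∫ f̂(ξ) conj(ĥ(ξ)) |ξ|^(2s) dξ`, which is real because `f` and `h`
are real-valued; it is written here as the real inner product of `L²(|ξ|^(2s) dξ)`. -/
instance : InnerProductSpace ℝ (HomSobolev s) where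
  norm_smul_le c f := by
    change ‖fourierLin s (c • f)‖ ≤ ‖c‖ * ‖fourierLin s f‖
    rw [map_smul]
    exact norm_smul_le _ _
  inner f h := inner ℝ (fourierLin s f) (fourierLin s h)
  norm_sq_eq_re_inner f := norm_sq_eq_re_inner (𝕜 := ℝ) (fourierLin s f)
  conj_inner_symm f h := inner_conj_symm (𝕜 := ℝ) (fourierLin s f) (fourierLin s h)
  add_left f f' h := by
    change inner ℝ (fourierLin s (f + f')) _ = _
    rw [map_add, inner_add_left]
  smul_left f h c := by
    change inner ℝ (fourierLin s (c • f)) _ = _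
    rw [map_smul, real_inner_smul_left]
    rfl

end HomSobolev

/-! ### Test functions as elements of the homogeneous Sobolev spaces -/

/-- A real-valued test function supported in `I`, as a complex-valued Schwartz function. -/
def testToSchwartz {I : Opens ℝ} (φ : 𝓓(I, ℝ)) : 𝓢(ℝ, ℂ) :=
  (φ.hasCompactSupport.comp_left (g := ((↑) : ℝ → ℂ)) Complex.ofReal_zero).toSchwartzMap
    (Complex.ofRealCLM.contDiff.comp φ.contDiff)

theorem testToSchwartz_apply {I : Opens ℝ} (φ : 𝓓(I, ℝ)) (x : ℝ) :
    testToSchwartz φ x = (φ x : ℂ) := rfl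

theorem homWeight_hasTemperateGrowth {s : ℝ} (hs : |s| < 1 / 2) :
    (homWeight s).HasTemperateGrowth := by
  obtain ⟨hs1, hs2⟩ := abs_lt.1 hs
  refine ⟨3, ?_⟩
  rw [homWeight, integrable_withDensity_iff (by fun_prop) (by simp)]
  have h01 : IntegrableOn (fun x : ℝ => |x| ^ (2 * s)) (Set.Icc (-1) 1) := by
    have h1 : IntervalIntegrable (fun x : ℝ => |x| ^ (2 * s)) volume 0 1 := by
      refine (intervalIntegral.intervalIntegrable_rpow' (by linarith : -1 < 2 * s)).congr ?_
      intro x hx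
      rw [Set.uIoc_of_le zero_le_one] at hx
      simp [abs_of_pos hx.1]
    have h2 : IntervalIntegrable (fun x : ℝ => |x| ^ (2 * s)) volume (-1) 0 := by
      have := (IntervalIntegrable.iff_comp_neg (f := fun x : ℝ => |x| ^ (2 * s))).1 h1.symm
      simpa using this
    have h3 := h2.trans h1
    rwa [intervalIntegrable_iff_integrableOn_Icc_of_le (by norm_num)] at h3
  have h2 : Integrable (fun x : ℝ => (1 + ‖x‖) ^ (-2 : ℝ)) :=
    integrable_one_add_norm (by simp)
  refine ((h01.integrable_indicator measurableSet_Icc).add h2).mono' (by fun_prop) ?_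
  refine Filter.Eventually.of_forall fun x => ?_
  have hp : (0 : ℝ) ≤ |x| ^ (2 * s) := by positivity
  have hx0 : (0 : ℝ) < 1 + ‖x‖ := by positivity
  rw [ENNReal.toReal_ofReal hp, Real.norm_of_nonneg (by positivity), Pi.add_apply]
  by_cases hx : x ∈ Set.Icc (-1 : ℝ) 1
  · rw [Set.indicator_of_mem hx]
    have h4 : (1 + ‖x‖) ^ (-((3 : ℕ) : ℝ)) ≤ 1 :=
      Real.rpow_le_one_of_one_le_of_nonpos (by linarith [norm_nonneg x]) (by norm_num)
    have h5 : (0 : ℝ) ≤ (1 + ‖x‖) ^ (-2 : ℝ) := by positivity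
    nlinarith
  · rw [Set.indicator_of_notMem hx, zero_add]
    have hx1 : 1 ≤ |x| := by
      by_contra hlt
      exact hx ((abs_le.1 (not_le.1 hlt).le))
    have h6 : |x| ^ (2 * s) ≤ (1 + ‖x‖) ^ (1 : ℝ) :=
      (Real.rpow_le_rpow_of_exponent_le hx1 (by linarith)).trans
        (Real.rpow_le_rpow (abs_nonneg x) (by simp) zero_le_one)
    calc _ ≤ (1 + ‖x‖) ^ (-((3 : ℕ) : ℝ)) * (1 + ‖x‖) ^ (1 : ℝ) := by gcongr
      _ = (1 + ‖x‖) ^ (-2 : ℝ) := by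
        rw [← Real.rpow_add hx0]
        norm_num

theorem hasFourierDensity_test {I : Opens ℝ} (φ : 𝓓(I, ℝ)) :
    HasFourierDensity (SchwartzMap.toTemperedDistributionCLM ℝ ℂ volume (testToSchwartz φ))
      (unitaryFourier (testToSchwartz φ)) := by
  refine ⟨(SchwartzMap.integrable _).locallyIntegrable, fun ψ => ⟨?_, ?_⟩⟩
  · exact (SchwartzMap.integrable (unitaryFourier (testToSchwartz φ))).bdd_mul
      ψ.continuous.aestronglyMeasurable
      (Filter.Eventually.of_forall (SchwartzMap.norm_le_seminorm ℂ ψ))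
  · rw [SchwartzMap.toTemperedDistributionCLM_apply_apply volume]
    exact integral_unitaryFourier_mul_eq _ _

theorem memLp_unitaryFourier {s : ℝ} (hs : |s| < 1 / 2) (ψ : 𝓢(ℝ, ℂ)) :
    MemLp (unitaryFourier ψ) 2 (homWeight s) :=
  have := homWeight_hasTemperateGrowth hs
  SchwartzMap.memLp _ 2 _

theorem isRealDistribution_test {I : Opens ℝ} (φ : 𝓓(I, ℝ)) : IsRealDistribution
    (SchwartzMap.toTemperedDistributionCLM ℝ ℂ volume (testToSchwartz φ)) := by
  intro ψ hψ
  rw [SchwartzMap.toTemperedDistributionCLM_apply_apply volume]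
  have : ∀ x, ψ x • testToSchwartz φ x = (((ψ x).re * φ x : ℝ) : ℂ) := by
    intro x
    rw [testToSchwartz_apply, Complex.ofReal_mul, smul_eq_mul]
    congr 1
    exact Complex.ext rfl (by simp [hψ x])
  simp_rw [this]
  rw [integral_complex_ofReal, Complex.ofReal_im]

/-- A test function `φ` as the element `ψ ↦ ∫ φ ψ` of `W̃^(s,2)(ℝ)`. -/
def testToHomSobolev {s : ℝ} (hs : |s| < 1 / 2) {I : Opens ℝ} (φ : 𝓓(I, ℝ)) : HomSobolev s :=
  ⟨SchwartzMap.toTemperedDistributionCLM ℝ ℂ volume (testToSchwartz φ),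
    isRealDistribution_test φ, unitaryFourier (testToSchwartz φ), hasFourierDensity_test φ,
    memLp_unitaryFourier hs _⟩

/-- On test functions the inner product is `∫ φ̂(ξ) conj(ψ̂(ξ)) |ξ|^(2s) dξ`. -/
theorem inner_testToHomSobolev {s : ℝ} (hs : |s| < 1 / 2) {I : Opens ℝ} (φ ψ : 𝓓(I, ℝ)) :
    inner ℝ (testToHomSobolev hs φ) (testToHomSobolev hs ψ) =
      (∫ ξ, unitaryFourier (testToSchwartz φ) ξ *
        (starRingEnd ℂ) (unitaryFourier (testToSchwartz ψ) ξ) * (|ξ| ^ (2 * s) : ℝ)).re := by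
  have h1 := memLp_unitaryFourier hs (testToSchwartz φ)
  have h2 := memLp_unitaryFourier hs (testToSchwartz ψ)
  have e1 : HomSobolev.fourierLin s (testToHomSobolev hs φ) = h1.toLp :=
    HomSobolev.fourierLp_eq _ (hasFourierDensity_test φ) _
  have e2 : HomSobolev.fourierLin s (testToHomSobolev hs ψ) = h2.toLp :=
    HomSobolev.fourierLp_eq _ (hasFourierDensity_test ψ) _
  change inner ℝ (HomSobolev.fourierLin s _) (HomSobolev.fourierLin s _) = _
  have hi : Integrable (fun ξ => unitaryFourier (testToSchwartz φ) ξ *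
      (starRingEnd ℂ) (unitaryFourier (testToSchwartz ψ) ξ)) (homWeight s) :=
    h1.integrable_mul h2.star
  have : ∀ᵐ ξ ∂(homWeight s), inner ℝ (h1.toLp _ ξ) (h2.toLp _ ξ) =
      RCLike.re (unitaryFourier (testToSchwartz φ) ξ *
        (starRingEnd ℂ) (unitaryFourier (testToSchwartz ψ) ξ)) := by
    filter_upwards [h1.coeFn_toLp, h2.coeFn_toLp] with ξ a b
    rw [a, b]
    simp [Complex.inner]
    ring
  rw [e1, e2, L2.inner_def, integral_congr_ae this, integral_re hi, homWeight,
    integral_withDensity_eq_integral_toReal_smul (by fun_prop) (by simp)]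
  simp only [RCLike.re_to_complex]
  congr 2
  ext ξ
  rw [ENNReal.toReal_ofReal (by positivity), Complex.real_smul, mul_comm]

/-- `W̃_0^(s,2)(I)`: the closure of the test functions supported in `I` in `W̃^(s,2)(ℝ)`. -/
def homSobolevZero {s : ℝ} (hs : |s| < 1 / 2) (I : Opens ℝ) : Set (HomSobolev s) :=
  closure (Set.range fun φ : 𝓓(I, ℝ) => testToHomSobolev hs φ)

theorem abs_half_sub_lt {H : ℝ} (hH : H ∈ Set.Ioo (0 : ℝ) 1) : |1 / 2 - H| < 1 / 2 := by
  rw [abs_lt]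
  constructor <;> linarith [hH.1, hH.2]

/-! ### Fractional Brownian motion -/

/-- `X` is a standard fractional Brownian motion on the line with Hurst index `H`: a centred
Gaussian process with stationary increments and `E X_t² = |t|^(2H)`. -/
structure IsFractionalBrownianMotion {Ω : Type*} [MeasurableSpace Ω] (H : ℝ) (X : ℝ → Ω → ℝ)
    (P : Measure Ω) : Prop where
  isGaussianProcess : IsGaussianProcess X P
  integral_eq_zero : ∀ t, ∫ ω, X t ω ∂P = 0
  integral_sq : ∀ t, ∫ ω, X t ω ^ 2 ∂P = |t| ^ (2 * H)
  /-- The finite-dimensional laws of `t ↦ X_(t+h) - X_h` do not depend on `h`. -/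
  stationary_increments : ∀ (h : ℝ) (T : Finset ℝ),
    P.map (fun ω (t : T) => X (t + h) ω - X h ω) = P.map (fun ω (t : T) => X t ω - X 0 ω)

namespace IsFractionalBrownianMotion

variable {Ω : Type*} [MeasurableSpace Ω] {H : ℝ} {X : ℝ → Ω → ℝ} {P : Measure Ω}

theorem memLp (hX : IsFractionalBrownianMotion H X P) (t : ℝ) : MemLp (X t) 2 P :=
  (hX.isGaussianProcess.hasGaussianLaw_eval t).memLp_two

/-- The random variable `X_t` as an element of `L²(P)`. -/
def path (hX : IsFractionalBrownianMotion H X P) (t : ℝ) : Lp ℝ 2 P := (hX.memLp t).toLp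

/-- `E_S`: the closed linear span of the increments `X_u - X_v`, `u, v ∈ S`, in `L²(P)`. -/
def incrementSpace (hX : IsFractionalBrownianMotion H X P) (S : Set ℝ) : Submodule ℝ (Lp ℝ 2 P) :=
  (Submodule.span ℝ {Z | ∃ u ∈ S, ∃ v ∈ S, Z = hX.path u - hX.path v}).topologicalClosure

/-- `∫ φ'(t) X_t dt`, the Bochner integral of an `L²(P)`-valued function. -/
def integralDeriv (hX : IsFractionalBrownianMotion H X P) {I : Opens ℝ} (φ : 𝓓(I, ℝ)) :
    Lp ℝ 2 P :=
  ∫ t : ℝ, deriv φ t • hX.path t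

theorem norm_path_sub_sq (hH : 0 < H) (hX : IsFractionalBrownianMotion H X P) (t u : ℝ) :
    ‖hX.path t - hX.path u‖ ^ 2 = |t - u| ^ (2 * H) := by
  have hm : ∀ t, AEMeasurable (X t) P := fun t => (hX.memLp t).1.aemeasurable
  have h0 : X 0 =ᵐ[P] 0 := by
    have := hX.integral_sq 0
    rw [abs_zero, Real.zero_rpow (by positivity), integral_eq_zero_iff_of_nonneg
      (fun ω => sq_nonneg _) (hX.memLp 0).integrable_sq] at this
    filter_upwards [this] with ω hω
    simpa using hω
  have key := hX.stationary_increments u {t - u}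
  have key2 := congrArg (fun μ : Measure (({t - u} : Finset ℝ) → ℝ) =>
    ∫ y, (y ⟨t - u, by simp⟩) ^ 2 ∂μ) key
  beta_reduce at key2
  have hmeas : ∀ h : ℝ, AEMeasurable (fun ω (r : ({t - u} : Finset ℝ)) => X (r + h) ω - X h ω) P :=
    fun h => aemeasurable_pi_lambda _ fun i => (hm _).sub (hm _)
  have hmeas0 : AEMeasurable (fun ω (r : ({t - u} : Finset ℝ)) => X r ω - X 0 ω) P :=
    aemeasurable_pi_lambda _ fun i => (hm _).sub (hm _)
  have hsq : Measurable fun y : ({t - u} : Finset ℝ) → ℝ => y ⟨t - u, by simp⟩ ^ 2 :=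
    (measurable_pi_apply _).pow_const 2
  rw [integral_map (hmeas u) hsq.aestronglyMeasurable,
    integral_map hmeas0 hsq.aestronglyMeasurable] at key2
  simp only [sub_add_cancel] at key2
  have e1 : ∫ ω, (X (t - u) ω - X 0 ω) ^ 2 ∂P = |t - u| ^ (2 * H) := by
    rw [← hX.integral_sq]
    refine integral_congr_ae ?_
    filter_upwards [h0] with ω hω
    simp [hω]
  rw [e1] at key2
  rw [← key2, ← real_inner_self_eq_norm_sq, L2.inner_def]
  refine integral_congr_ae ?_
  filter_upwards [Lp.coeFn_sub (hX.path t) (hX.path u), (hX.memLp t).coeFn_toLp,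
    (hX.memLp u).coeFn_toLp] with ω h1 h2 h3
  rw [h1, Pi.sub_apply]
  simp only [path, h2, h3]
  simp [sq]

/-- The integrand defining `∫ φ'(t) X_t dt` is Bochner integrable. -/
theorem integrable_deriv_smul_path (hH : 0 < H) (hX : IsFractionalBrownianMotion H X P)
    {I : Opens ℝ} (φ : 𝓓(I, ℝ)) : Integrable fun t : ℝ => deriv φ t • hX.path t := by
  have hc : Continuous hX.path := by
    rw [continuous_iff_continuousAt]
    intro u
    rw [ContinuousAt, tendsto_iff_norm_sub_tendsto_zero]
    have h1 : ∀ t, ‖hX.path t - hX.path u‖ = √(|t - u| ^ (2 * H)) := fun t => by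
      rw [← hX.norm_path_sub_sq hH t u, Real.sqrt_sq (norm_nonneg _)]
    simp_rw [h1]
    have h2 : Continuous fun t : ℝ => √(|t - u| ^ (2 * H)) := by
      refine ((continuous_abs.comp (continuous_id.sub continuous_const)).rpow_const
        fun x => Or.inr (by positivity)).sqrt
    simpa [Real.zero_rpow (by positivity : 2 * H ≠ 0)] using h2.tendsto u
  refine Continuous.integrable_of_hasCompactSupport
    ((φ.contDiff.continuous_deriv (by simp)).smul hc) ?_
  exact φ.hasCompactSupport.deriv.smul_right

end IsFractionalBrownianMotion

end

/-! ### The integral of `(1 - cos x) x ^ (-1 - 2H)` -/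

/-! Write κ for sin(πH) Γ(1+2H). Stationarity gives E(X_t - X_u)² = |t-u|^(2H). Since φ' and ψ' have
integral zero, polarisation turns the covariance of ∫ φ'X and ∫ ψ'X into -1/2 ∬ φ'(t) ψ'(u)
|t-u|^(2H) (`inner_integralDeriv`). The spectral formula |t|^(2H) = (κ/π) ∫ (1 - cos tξ) |ξ|^(-1-2H)
dξ (`integral_one_sub_cos_mul`) diagonalises this form. Each derivative contributes a factor ξ, and
ξ² |ξ|^(-1-2H) = |ξ|^(2(1/2-H)) is the Sobolev weight (`inner_integralDeriv_eq`).

Hence φ ↦ κ^(-1/2) ∫ φ'X preserves norms on test functions. These are dense in the Sobolev space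
(`denseRange_testLin`), so the map extends to a linear isometry L into L²(P), and J is its inverse.
The Sobolev space is complete (`HomSobolev.completeSpace`), so L commutes with closures and sends
the closure of the test functions on I to the closed span of their integrals. For an interval I that
span is E_I (`incrementSpace_eq_topologicalClosure`): φ' has mean zero and support in I, and
conversely a difference of two mollified Dirac masses in I is the derivative of a test function on
I. -/

theorem integral_one_sub_cos_mul_exp_neg {y : ℝ} (hy : 0 < y) :
    IntegrableOn (fun x => (1 - Real.cos x) * Real.exp (-(x * y))) (Set.Ioi 0) ∧
    ∫ x in Set.Ioi (0 : ℝ), (1 - Real.cos x) * Real.exp (-(x * y)) = (y * (1 + y ^ 2))⁻¹ := by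
  have h1 : ((-y : ℝ) : ℂ).re < 0 := by simpa
  have h2 : (((-y : ℝ) : ℂ) + Complex.I).re < 0 := by simpa
  have i1 := (integrableOn_exp_mul_complex_Ioi h1 0).re
  have i2 := (integrableOn_exp_mul_complex_Ioi h2 0).re
  have e1 := integral_exp_mul_complex_Ioi h1 0
  have e2 := integral_exp_mul_complex_Ioi h2 0
  have r1 := integral_re (integrableOn_exp_mul_complex_Ioi h1 0)
  have r2 := integral_re (integrableOn_exp_mul_complex_Ioi h2 0)
  rw [e1] at r1
  rw [e2] at r2
  have hfun : ∀ x : ℝ, (1 - Real.cos x) * Real.exp (-(x * y)) =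
      RCLike.re (Complex.exp (((-y : ℝ) : ℂ) * x)) -
        RCLike.re (Complex.exp ((((-y : ℝ) : ℂ) + Complex.I) * x)) := by
    intro x
    simp [Complex.exp_re]
    ring_nf
  have hy2 : y * y + 1 ≠ 0 := by positivity
  simp_rw [hfun]
  refine ⟨i1.sub i2, ?_⟩
  rw [integral_sub i1 i2, r1, r2]
  simp [Complex.div_re, Complex.normSq]
  field_simp
  ring

/-- The Gamma integral as a lower Lebesgue integral, so that the order of integration can be
exchanged below by Tonelli with no integrability to check. -/
theorem lintegral_rpow_mul_exp_neg_mul_rpow {p q b : ℝ} (hp : 0 < p) (hq : -1 < q) (hb : 0 < b) :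
    ∫⁻ x in Set.Ioi (0 : ℝ), ENNReal.ofReal (x ^ q * Real.exp (-b * x ^ p)) =
      ENNReal.ofReal (b ^ (-(q + 1) / p) * (1 / p) * Real.Gamma ((q + 1) / p)) := by
  rw [← integral_rpow_mul_exp_neg_mul_rpow hp hq hb, ofReal_integral_eq_lintegral_ofReal]
  -- Integrability follows from the value: the Bochner integral of a non-integrable function is 0,
  -- while the Gamma expression is positive.
  · by_contra hn
    have := integral_undef hn
    rw [integral_rpow_mul_exp_neg_mul_rpow hp hq hb] at this
    have h3 : 0 < (q + 1) / p := div_pos (by linarith) hp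
    have := Real.Gamma_pos_of_pos h3
    have : 0 < b ^ (-(q + 1) / p) * (1 / p) * Real.Gamma ((q + 1) / p) := by positivity
    linarith
  · filter_upwards [ae_restrict_mem measurableSet_Ioi] with x hx
    have : (0 : ℝ) < x := hx
    simp only [Pi.zero_apply]
    positivity

/-- Write 1/(1+y²) = ∫ e^(-z(1+y²)) dz over z > 0 and exchange. The y-integral is Γ(H)/2 · z^(-H)
e^(-z), the z-integral then gives Γ(H)Γ(1-H)/2, and the reflection formula concludes. -/
theorem lintegral_rpow_div_one_add_sq {H : ℝ} (hH : H ∈ Set.Ioo (0 : ℝ) 1) :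
    ∫⁻ y in Set.Ioi (0 : ℝ), ENNReal.ofReal (y ^ (2 * H - 1) / (1 + y ^ 2)) =
      ENNReal.ofReal (Real.pi / (2 * Real.sin (Real.pi * H))) := by
  have h0 := hH.1
  have h1 := hH.2
  calc _ = ∫⁻ y in Set.Ioi (0 : ℝ), ∫⁻ z in Set.Ioi (0 : ℝ),
        ENNReal.ofReal (y ^ (2 * H - 1) * Real.exp (-z * (1 + y ^ 2))) := by
        refine setLIntegral_congr_fun measurableSet_Ioi fun y hy => ?_
        have hy : 0 < y := hy
        have hb : 0 < 1 + y ^ 2 := by positivity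
        have := lintegral_rpow_mul_exp_neg_mul_rpow (p := 1) (q := 0) one_pos (by norm_num) hb
        simp only [Real.rpow_zero, Real.rpow_one, one_mul] at this
        have hc : 0 ≤ y ^ (2 * H - 1) := by positivity
        simp_rw [ENNReal.ofReal_mul hc]
        rw [lintegral_const_mul _ (by fun_prop)]
        have e : ∀ z : ℝ, -z * (1 + y ^ 2) = -(1 + y ^ 2) * z := fun z => by ring
        simp_rw [e]
        rw [this, ← ENNReal.ofReal_mul hc]
        congr 1
        norm_num
        rw [Real.rpow_neg_one]
        rfl
    _ = ∫⁻ z in Set.Ioi (0 : ℝ), ∫⁻ y in Set.Ioi (0 : ℝ),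
        ENNReal.ofReal (y ^ (2 * H - 1) * Real.exp (-z * (1 + y ^ 2))) := by
        rw [lintegral_lintegral_swap (by fun_prop)]
    _ = ∫⁻ z in Set.Ioi (0 : ℝ), ENNReal.ofReal (Real.Gamma H / 2) *
          ENNReal.ofReal (z ^ (-H) * Real.exp (-1 * z ^ (1 : ℝ))) := by
        refine setLIntegral_congr_fun measurableSet_Ioi fun z hz => ?_
        have hz : 0 < z := hz
        have := lintegral_rpow_mul_exp_neg_mul_rpow (p := 2) (q := 2 * H - 1) two_pos
          (by linarith) hz
        have e : ∀ y : ℝ, y ^ (2 * H - 1) * Real.exp (-z * (1 + y ^ 2)) =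
            Real.exp (-z) * (y ^ (2 * H - 1) * Real.exp (-z * y ^ (2 : ℝ))) := fun y => by
          rw [mul_add, Real.exp_add, Real.rpow_two]
          ring_nf
        simp_rw [e, ENNReal.ofReal_mul (Real.exp_pos (-z)).le]
        rw [lintegral_const_mul _ (by fun_prop), this, ← ENNReal.ofReal_mul (by positivity),
          ← ENNReal.ofReal_mul (by have := Real.Gamma_pos_of_pos h0; positivity)]
        congr 1
        have e1 : -(2 * H - 1 + 1) / 2 = -H := by ring
        have e2 : (2 * H - 1 + 1) / 2 = H := by ring
        rw [e1, e2, Real.rpow_one]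
        ring_nf
    _ = _ := by
        rw [lintegral_const_mul _ (by fun_prop),
          lintegral_rpow_mul_exp_neg_mul_rpow one_pos (by linarith) one_pos,
          ← ENNReal.ofReal_mul (by have := Real.Gamma_pos_of_pos h0; positivity)]
        congr 1
        have e1 : (-H + 1) / 1 = 1 - H := by ring
        rw [e1, Real.one_rpow, mul_comm 2, ← div_div, ← Real.Gamma_mul_Gamma_one_sub]
        ring

/-- Write Γ(1+2H) x^(-1-2H) = ∫ y^(2H) e^(-xy) dy over y > 0 and exchange; the x-integral is the
Laplace transform of 1 - cos. -/
theorem lintegral_one_sub_cos_mul_rpow {H : ℝ} (hH : H ∈ Set.Ioo (0 : ℝ) 1) :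
    ∫⁻ x in Set.Ioi (0 : ℝ), ENNReal.ofReal ((1 - Real.cos x) * x ^ (-1 - 2 * H)) =
      ENNReal.ofReal (Real.pi / (2 * (Real.sin (Real.pi * H) * Real.Gamma (1 + 2 * H)))) := by
  have h0 := hH.1
  have h1 := hH.2
  have hG : 0 < Real.Gamma (1 + 2 * H) := Real.Gamma_pos_of_pos (by linarith)
  calc _ = ∫⁻ x in Set.Ioi (0 : ℝ), ∫⁻ y in Set.Ioi (0 : ℝ),
        ENNReal.ofReal ((1 - Real.cos x) / Real.Gamma (1 + 2 * H) *
          (y ^ (2 * H) * Real.exp (-(x * y)))) := by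
        refine setLIntegral_congr_fun measurableSet_Ioi fun x hx => ?_
        have hx : 0 < x := hx
        have := lintegral_rpow_mul_exp_neg_mul_rpow (p := 1) (q := 2 * H) one_pos
          (by linarith) hx
        have hc : 0 ≤ (1 - Real.cos x) / Real.Gamma (1 + 2 * H) :=
          div_nonneg (by linarith [Real.cos_le_one x]) hG.le
        simp only [Real.rpow_one, neg_mul] at this
        simp_rw [ENNReal.ofReal_mul hc]
        rw [lintegral_const_mul _ (by fun_prop), this, ← ENNReal.ofReal_mul hc]
        congr 1
        have e1 : -(2 * H + 1) / 1 = -1 - 2 * H := by ring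
        have e2 : (2 * H + 1) / 1 = 1 + 2 * H := by ring
        rw [e1, e2]
        field_simp
    _ = ∫⁻ y in Set.Ioi (0 : ℝ), ∫⁻ x in Set.Ioi (0 : ℝ),
        ENNReal.ofReal ((1 - Real.cos x) / Real.Gamma (1 + 2 * H) *
          (y ^ (2 * H) * Real.exp (-(x * y)))) := by
        rw [lintegral_lintegral_swap (by fun_prop)]
    _ = ∫⁻ y in Set.Ioi (0 : ℝ), ENNReal.ofReal (1 / Real.Gamma (1 + 2 * H)) *
          ENNReal.ofReal (y ^ (2 * H - 1) / (1 + y ^ 2)) := by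
        refine setLIntegral_congr_fun measurableSet_Ioi fun y hy => ?_
        have hy : 0 < y := hy
        obtain ⟨hi, he⟩ := integral_one_sub_cos_mul_exp_neg hy
        have e : ∀ x : ℝ, (1 - Real.cos x) / Real.Gamma (1 + 2 * H) *
          (y ^ (2 * H) * Real.exp (-(x * y))) = (y ^ (2 * H) / Real.Gamma (1 + 2 * H)) *
            ((1 - Real.cos x) * Real.exp (-(x * y))) := fun x => by ring
        have hc : 0 ≤ y ^ (2 * H) / Real.Gamma (1 + 2 * H) := by positivity
        simp_rw [e, ENNReal.ofReal_mul hc]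
        rw [lintegral_const_mul _ (by fun_prop), ← ofReal_integral_eq_lintegral_ofReal hi, he,
          ← ENNReal.ofReal_mul hc, ← ENNReal.ofReal_mul (by positivity)]
        · congr 1
          rw [Real.rpow_sub_one hy.ne']
          field_simp
        · refine Filter.Eventually.of_forall fun x => ?_
          exact mul_nonneg (by linarith [Real.cos_le_one x]) (Real.exp_pos _).le
    _ = _ := by
        rw [lintegral_const_mul _ (by fun_prop), lintegral_rpow_div_one_add_sq hH,
          ← ENNReal.ofReal_mul (by positivity)]
        congr 1
        field_simp

theorem sin_mul_Gamma_pos {H : ℝ} (hH : H ∈ Set.Ioo (0 : ℝ) 1) :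
    0 < Real.sin (Real.pi * H) * Real.Gamma (1 + 2 * H) := by
  have h0 := hH.1
  have h1 := hH.2
  have hpi := Real.pi_pos
  exact mul_pos (Real.sin_pos_of_pos_of_lt_pi (by positivity) (by nlinarith))
    (Real.Gamma_pos_of_pos (by linarith))

theorem integral_one_sub_cos_mul_abs_rpow {H : ℝ} (hH : H ∈ Set.Ioo (0 : ℝ) 1) :
    Integrable (fun x : ℝ => (1 - Real.cos x) * |x| ^ (-1 - 2 * H)) ∧
    ∫ x : ℝ, (1 - Real.cos x) * |x| ^ (-1 - 2 * H) =
      Real.pi / (Real.sin (Real.pi * H) * Real.Gamma (1 + 2 * H)) := by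
  have ha := sin_mul_Gamma_pos hH
  have hpi := Real.pi_pos
  have key := lintegral_one_sub_cos_mul_rpow hH
  have hnn : 0 ≤ᵐ[volume.restrict (Set.Ioi 0)]
      fun x : ℝ => (1 - Real.cos x) * x ^ (-1 - 2 * H) := by
    filter_upwards [ae_restrict_mem measurableSet_Ioi] with x hx
    have hx : 0 < x := hx
    exact mul_nonneg (by linarith [Real.cos_le_one x]) (by positivity)
  have hm : Measurable fun x : ℝ => (1 - Real.cos x) * x ^ (-1 - 2 * H) := by fun_prop
  have hi : IntegrableOn (fun x : ℝ => (1 - Real.cos x) * x ^ (-1 - 2 * H)) (Set.Ioi 0) := by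
    refine ⟨hm.aestronglyMeasurable, ?_⟩
    rw [hasFiniteIntegral_iff_ofReal hnn, key]
    exact ENNReal.ofReal_lt_top
  have hcos : (fun x : ℝ => (1 - Real.cos x) * |x| ^ (-1 - 2 * H)) =
      fun x => (fun y : ℝ => (1 - Real.cos y) * y ^ (-1 - 2 * H)) |x| := by
    ext x
    simp
  rw [hcos]
  constructor
  · rw [← integrableOn_univ, ← Set.Iic_union_Ioi (a := (0 : ℝ))]
    have h2 : IntegrableOn (fun x : ℝ => (1 - Real.cos |x|) * |x| ^ (-1 - 2 * H)) (Set.Ioi 0) :=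
      hi.congr_fun (fun x hx => by simp [abs_of_pos (show 0 < x from hx)]) measurableSet_Ioi
    refine IntegrableOn.union ?_ h2
    -- The endpoint 0 is added so that reflection yields the closed half-line `Set.Iic 0`.
    rw [← integrableOn_Ici_iff_integrableOn_Ioi] at h2
    have := h2.comp_neg
    simpa using this
  · rw [integral_comp_abs (f := fun y : ℝ => (1 - Real.cos y) * y ^ (-1 - 2 * H)),
      integral_eq_lintegral_of_nonneg_ae hnn hm.aestronglyMeasurable, key,
      ENNReal.toReal_ofReal (by positivity)]
    field_simp

/-- The spectral formula for |t|^(2H), obtained by the substitution x ↦ tx for t ≠ 0. -/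
theorem integral_one_sub_cos_mul {H : ℝ} (hH : H ∈ Set.Ioo (0 : ℝ) 1) (t : ℝ) :
    Integrable (fun x : ℝ => (1 - Real.cos (t * x)) * |x| ^ (-1 - 2 * H)) ∧
    ∫ x : ℝ, (1 - Real.cos (t * x)) * |x| ^ (-1 - 2 * H) =
      Real.pi / (Real.sin (Real.pi * H) * Real.Gamma (1 + 2 * H)) * |t| ^ (2 * H) := by
  obtain ⟨hi, he⟩ := integral_one_sub_cos_mul_abs_rpow hH
  have h0 := hH.1
  rcases eq_or_ne t 0 with rfl | ht
  · have h2 : 2 * H ≠ 0 := by positivity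
    simp [Real.zero_rpow h2]
  have ht' : 0 < |t| := abs_pos.2 ht
  have e : ∀ x : ℝ, (1 - Real.cos (t * x)) * |x| ^ (-1 - 2 * H) =
      |t| ^ (1 + 2 * H) * ((1 - Real.cos (t * x)) * |t * x| ^ (-1 - 2 * H)) := fun x => by
    rw [abs_mul, Real.mul_rpow (abs_nonneg _) (abs_nonneg _), mul_left_comm,
      ← mul_assoc (|t| ^ (1 + 2 * H)), ← Real.rpow_add ht']
    ring_nf
    simp
  simp_rw [e]
  refine ⟨(hi.comp_mul_left' ht).const_mul _, ?_⟩
  rw [integral_const_mul, Measure.integral_comp_mul_left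
    (fun x : ℝ => (1 - Real.cos x) * |x| ^ (-1 - 2 * H)), he, smul_eq_mul, Real.rpow_add ht',
    Real.rpow_one, abs_inv]
  field_simp

/-! ### The covariance of the integrals against derivatives of test functions -/

/-- Insert the spectral formula, apply Fubini and expand cos((t-u)ξ). The constant 1 in 1 - cos
contributes (∫a)(∫b) = 0; what remains is minus the product of the transforms. -/
theorem integral_prod_mul_abs_sub_rpow {H : ℝ} (hH : H ∈ Set.Ioo (0 : ℝ) 1) {a b : ℝ → ℝ}
    (ha : Continuous a) (hb : Continuous b) (ha' : HasCompactSupport a)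
    (hb' : HasCompactSupport b) (ha0 : ∫ t, a t = 0) :
    ∫ z : ℝ × ℝ, a z.1 * b z.2 * |z.1 - z.2| ^ (2 * H) =
      -(Real.sin (Real.pi * H) * Real.Gamma (1 + 2 * H) / Real.pi) *
        ∫ ξ, ((∫ t, a t * Real.cos (t * ξ)) * (∫ t, b t * Real.cos (t * ξ)) +
          (∫ t, a t * Real.sin (t * ξ)) * (∫ t, b t * Real.sin (t * ξ))) *
            |ξ| ^ (-1 - 2 * H) := by
  have hpos := sin_mul_Gamma_pos hH
  have h0 := hH.1
  have hk := integral_one_sub_cos_mul hH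
  generalize Real.sin (Real.pi * H) * Real.Gamma (1 + 2 * H) = κ at hpos hk ⊢
  have hpi := Real.pi_pos
  have hcs : HasCompactSupport fun z : ℝ × ℝ => a z.1 * b z.2 := by
    refine HasCompactSupport.intro (ha'.prod hb') fun z hz => ?_
    simp only [Set.mem_prod, not_and_or] at hz
    rcases hz with hz | hz
    · simp [image_eq_zero_of_notMem_tsupport hz]
    · simp [image_eq_zero_of_notMem_tsupport hz]
  have hpow : Continuous fun z : ℝ × ℝ => |z.1 - z.2| ^ (2 * H) :=
    ((continuous_fst.sub continuous_snd).abs).rpow_const fun x => Or.inr (by positivity)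
  have hab : Continuous fun z : ℝ × ℝ => a z.1 * b z.2 := by fun_prop
  let F : ℝ × ℝ → ℝ → ℝ := fun z ξ =>
    a z.1 * b z.2 * ((1 - Real.cos ((z.1 - z.2) * ξ)) * |ξ| ^ (-1 - 2 * H))
  have hFm : AEStronglyMeasurable (Function.uncurry F)
      ((volume : Measure (ℝ × ℝ)).prod volume) := by
    refine Measurable.aestronglyMeasurable ?_
    have := ha.measurable
    have := hb.measurable
    unfold F Function.uncurry
    fun_prop
  -- The kernel is nonnegative, so the spectral formula also evaluates the integral of the absolute
  -- value. The result is continuous with compact support in z, which justifies Fubini.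
  have hnorm : ∀ z : ℝ × ℝ, ∫ ξ, ‖F z ξ‖ = ‖a z.1 * b z.2 * |z.1 - z.2| ^ (2 * H)‖ *
      (Real.pi / κ) := fun z => by
    have e : ∀ ξ, ‖F z ξ‖ = ‖a z.1 * b z.2‖ *
        ((1 - Real.cos ((z.1 - z.2) * ξ)) * |ξ| ^ (-1 - 2 * H)) := fun ξ => by
      have hnn : 0 ≤ (1 - Real.cos ((z.1 - z.2) * ξ)) * |ξ| ^ (-1 - 2 * H) :=
        mul_nonneg (by linarith [Real.cos_le_one ((z.1 - z.2) * ξ)]) (by positivity)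
      rw [norm_mul (a z.1 * b z.2), Real.norm_of_nonneg hnn]
    simp_rw [e]
    rw [integral_const_mul, (hk _).2, norm_mul (a z.1 * b z.2),
      Real.norm_of_nonneg (by positivity : 0 ≤ |z.1 - z.2| ^ (2 * H))]
    ring
  have hFi : Integrable (Function.uncurry F) ((volume : Measure (ℝ × ℝ)).prod volume) := by
    rw [integrable_prod_iff hFm]
    refine ⟨Filter.Eventually.of_forall fun z =>
      (hk (z.1 - z.2)).1.const_mul (a z.1 * b z.2), ?_⟩
    simp only [Function.uncurry_apply_pair]
    simp_rw [hnorm]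
    exact ((hab.mul hpow).integrable_of_hasCompactSupport hcs.mul_right).norm.mul_const _
  have hswap := integral_integral_swap hFi
  have e1 : ∀ z : ℝ × ℝ, a z.1 * b z.2 * |z.1 - z.2| ^ (2 * H) =
      (κ / Real.pi) * ∫ ξ, F z ξ := fun z => by
    rw [integral_const_mul, (hk _).2]
    field_simp
  simp_rw [e1]
  rw [integral_const_mul, hswap, neg_mul, ← mul_neg, ← integral_neg]
  congr 1
  refine integral_congr_ae (Filter.Eventually.of_forall fun ξ => ?_)
  beta_reduce
  have hi : ∀ f : ℝ → ℝ, Continuous f → Integrable (fun t => a t * f t) := fun f hf =>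
    (ha.mul hf).integrable_of_hasCompactSupport ha'.mul_right
  have hi' : ∀ f : ℝ → ℝ, Continuous f → Integrable (fun t => b t * f t) := fun f hf =>
    (hb.mul hf).integrable_of_hasCompactSupport hb'.mul_right
  have i0 := (ha.integrable_of_hasCompactSupport (μ := volume) ha').mul_prod
    (hb.integrable_of_hasCompactSupport (μ := volume) hb')
  have i1 := (hi (fun t => Real.cos (t * ξ)) (by fun_prop)).mul_prod
    (hi' (fun t => Real.cos (t * ξ)) (by fun_prop))
  have i2 := (hi (fun t => Real.sin (t * ξ)) (by fun_prop)).mul_prod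
    (hi' (fun t => Real.sin (t * ξ)) (by fun_prop))
  have e2 : ∀ z : ℝ × ℝ, F z ξ = (a z.1 * b z.2 -
      (a z.1 * Real.cos (z.1 * ξ)) * (b z.2 * Real.cos (z.2 * ξ)) -
      (a z.1 * Real.sin (z.1 * ξ)) * (b z.2 * Real.sin (z.2 * ξ))) * |ξ| ^ (-1 - 2 * H) :=
    fun z => by
      simp only [F]
      rw [sub_mul z.1, Real.cos_sub]
      ring
  simp_rw [e2]
  have i01 := i0.sub i1
  simp only [Pi.sub_def] at i01
  rw [integral_mul_const, Measure.volume_eq_prod, integral_sub i01 i2, integral_sub i0 i1,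
    integral_prod_mul,
    integral_prod_mul (fun t => a t * Real.cos (t * ξ)) (fun t => b t * Real.cos (t * ξ)),
    integral_prod_mul (fun t => a t * Real.sin (t * ξ)) (fun t => b t * Real.sin (t * ξ)), ha0]
  ring

/-! ### Integration by parts for test functions, and their Fourier transform in real form -/

section TestFunctions

variable {I : Opens ℝ} (φ : 𝓓(I, ℝ))

theorem TestFunction.continuous_deriv : Continuous (deriv φ) :=
  φ.contDiff.continuous_deriv (by simp)

theorem TestFunction.hasDerivAt (x : ℝ) : HasDerivAt φ (deriv φ x) x :=
  ((φ.contDiff.differentiable (by simp)) x).hasDerivAt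

theorem TestFunction.integral_deriv_eq_zero : ∫ t, deriv φ t = 0 :=
  integral_eq_zero_of_hasDerivAt_of_integrable φ.hasDerivAt
    (φ.continuous_deriv.integrable_of_hasCompactSupport φ.hasCompactSupport.deriv)
    (φ.continuous.integrable_of_hasCompactSupport φ.hasCompactSupport)

theorem TestFunction.integral_deriv_mul {f f' : ℝ → ℝ} (hf : ∀ x, HasDerivAt f (f' x) x)
    (hf' : Continuous f') : ∫ t, deriv φ t * f t = -∫ t, φ t * f' t := by
  have hc : Continuous f := continuous_iff_continuousAt.2 fun x => (hf x).continuousAt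
  have := integral_mul_deriv_eq_deriv_mul_of_integrable (u := φ) (v := f) (u' := deriv φ)
    (fun x _ => φ.hasDerivAt x) (fun x _ => hf x)
    ((φ.continuous.mul hf').integrable_of_hasCompactSupport φ.hasCompactSupport.mul_right)
    ((φ.continuous_deriv.mul hc).integrable_of_hasCompactSupport
      φ.hasCompactSupport.deriv.mul_right)
    ((φ.continuous.mul hc).integrable_of_hasCompactSupport φ.hasCompactSupport.mul_right)
  rw [this, neg_neg]

theorem TestFunction.integral_deriv_mul_cos (ξ : ℝ) :
    ∫ t, deriv φ t * Real.cos (t * ξ) = ξ * ∫ t, φ t * Real.sin (t * ξ) := by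
  rw [φ.integral_deriv_mul (f' := fun t => -Real.sin (t * ξ) * ξ) (fun x => ?_) (by fun_prop),
    ← integral_const_mul, ← integral_neg]
  · congr 1
    ext t
    ring
  · exact (hasDerivAt_mul_const ξ).cos

theorem TestFunction.integral_deriv_mul_sin (ξ : ℝ) :
    ∫ t, deriv φ t * Real.sin (t * ξ) = -(ξ * ∫ t, φ t * Real.cos (t * ξ)) := by
  rw [φ.integral_deriv_mul (f' := fun t => Real.cos (t * ξ) * ξ) (fun x => ?_) (by fun_prop),
    ← integral_const_mul]
  · congr 2
    ext t
    ring
  · exact (hasDerivAt_mul_const ξ).sin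

/-- Separates real and imaginary parts, to match the cosine and sine integrals in the covariance. -/
theorem unitaryFourier_test (ξ : ℝ) : unitaryFourier (testToSchwartz φ) ξ =
    (((√(2 * Real.pi))⁻¹ * ∫ t, φ t * Real.cos (t * ξ) : ℝ) : ℂ) -
      (((√(2 * Real.pi))⁻¹ * ∫ t, φ t * Real.sin (t * ξ) : ℝ) : ℂ) * Complex.I := by
  have hi : ∀ f : ℝ → ℝ, Continuous f → Integrable (fun t => ((φ t * f t : ℝ) : ℂ)) := fun f hf =>
    ((φ.continuous.mul hf).integrable_of_hasCompactSupport φ.hasCompactSupport.mul_right).ofReal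
  rw [unitaryFourier_apply, Complex.ofReal_mul, Complex.ofReal_mul, mul_assoc, ← mul_sub,
    ← integral_complex_ofReal, ← integral_complex_ofReal, ← integral_mul_const,
    ← integral_sub (hi _ (by fun_prop)) ((hi _ (by fun_prop)).mul_const _)]
  congr 2
  ext t
  have e : -(Complex.I * t * ξ) = ((-(t * ξ) : ℝ) : ℂ) * Complex.I := by
    push_cast
    ring
  rw [testToSchwartz_apply, e, Complex.exp_mul_I, ← Complex.ofReal_cos, ← Complex.ofReal_sin,
    Real.cos_neg, Real.sin_neg]
  push_cast
  ring

end TestFunctions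

theorem re_unitaryFourier_mul_conj {I : Opens ℝ} (φ ψ : 𝓓(I, ℝ)) (ξ : ℝ) :
    (unitaryFourier (testToSchwartz φ) ξ *
      (starRingEnd ℂ) (unitaryFourier (testToSchwartz ψ) ξ)).re = (2 * Real.pi)⁻¹ *
        ((∫ t, φ t * Real.cos (t * ξ)) * (∫ t, ψ t * Real.cos (t * ξ)) +
          (∫ t, φ t * Real.sin (t * ξ)) * (∫ t, ψ t * Real.sin (t * ξ))) := by
  have h : (2 * Real.pi)⁻¹ = (√(2 * Real.pi))⁻¹ * (√(2 * Real.pi))⁻¹ := by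
    rw [← mul_inv, Real.mul_self_sqrt (by positivity)]
  rw [unitaryFourier_test, unitaryFourier_test, h]
  generalize (√(2 * Real.pi))⁻¹ = c
  simp [Complex.mul_re]
  ring

theorem integrable_unitaryFourier_mul_conj {s : ℝ} (hs : |s| < 1 / 2) (φ ψ : 𝓢(ℝ, ℂ)) :
    Integrable fun ξ => unitaryFourier φ ξ * (starRingEnd ℂ) (unitaryFourier ψ ξ) *
      ((|ξ| ^ (2 * s) : ℝ) : ℂ) := by
  have hi : Integrable (fun ξ => unitaryFourier φ ξ *
      (starRingEnd ℂ) (unitaryFourier ψ ξ)) (homWeight s) :=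
    (memLp_unitaryFourier hs φ).integrable_mul (memLp_unitaryFourier hs ψ).star
  rw [homWeight, integrable_withDensity_iff_integrable_smul' (by fun_prop) (by simp)] at hi
  refine hi.congr (Filter.Eventually.of_forall fun ξ => ?_)
  simp only
  rw [ENNReal.toReal_ofReal (by positivity), Complex.real_smul, mul_comm]

namespace IsFractionalBrownianMotion

variable {Ω : Type*} [MeasurableSpace Ω] {H : ℝ} {X : ℝ → Ω → ℝ} {P : Measure Ω}

theorem continuous_path (hH : 0 < H) (hX : IsFractionalBrownianMotion H X P) :
    Continuous hX.path := by
  rw [continuous_iff_continuousAt]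
  intro u
  rw [ContinuousAt, tendsto_iff_norm_sub_tendsto_zero]
  have h1 : ∀ t, ‖hX.path t - hX.path u‖ = √(|t - u| ^ (2 * H)) := fun t => by
    rw [← hX.norm_path_sub_sq hH t u, Real.sqrt_sq (norm_nonneg _)]
  simp_rw [h1]
  have h2 : Continuous fun t : ℝ => √(|t - u| ^ (2 * H)) := by
    refine ((continuous_abs.comp (continuous_id.sub continuous_const)).rpow_const
      fun x => Or.inr (by positivity)).sqrt
  simpa [Real.zero_rpow (by positivity : 2 * H ≠ 0)] using h2.tendsto u

/-- Polarisation: 2⟨X_t, X_u⟩ = ‖X_t‖² + ‖X_u‖² - |t-u|^(2H). Each of the first two terms depends on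
one variable only, and the derivative in the other variable integrates to zero. -/
theorem inner_integralDeriv (hH : 0 < H) (hX : IsFractionalBrownianMotion H X P)
    {I : Opens ℝ} (φ ψ : 𝓓(I, ℝ)) :
    inner ℝ (hX.integralDeriv φ) (hX.integralDeriv ψ) =
      -(1 / 2) * ∫ z : ℝ × ℝ, deriv φ z.1 * deriv ψ z.2 * |z.1 - z.2| ^ (2 * H) := by
  have hc := hX.continuous_path hH
  have hφ := hX.integrable_deriv_smul_path hH φ
  have hψ := hX.integrable_deriv_smul_path hH ψ
  have hcs : HasCompactSupport fun z : ℝ × ℝ => deriv φ z.1 * deriv ψ z.2 := by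
    refine HasCompactSupport.intro (φ.hasCompactSupport.deriv.prod ψ.hasCompactSupport.deriv)
      fun z hz => ?_
    simp only [Set.mem_prod, not_and_or] at hz
    rcases hz with hz | hz
    · simp [image_eq_zero_of_notMem_tsupport hz]
    · simp [image_eq_zero_of_notMem_tsupport hz]
  have hab : Continuous fun z : ℝ × ℝ => deriv φ z.1 * deriv ψ z.2 := by
    have := φ.continuous_deriv
    have := ψ.continuous_deriv
    fun_prop
  have hi : ∀ f : ℝ × ℝ → ℝ, Continuous f →
      Integrable (fun z : ℝ × ℝ => deriv φ z.1 * deriv ψ z.2 * f z) := fun f hf =>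
    (hab.mul hf).integrable_of_hasCompactSupport hcs.mul_right
  have e1 : inner ℝ (hX.integralDeriv φ) (hX.integralDeriv ψ) =
      ∫ t, ∫ u, deriv φ t * deriv ψ u * inner ℝ (hX.path t) (hX.path u) := by
    rw [integralDeriv, real_inner_comm, ← integral_inner hφ]
    congr 1
    ext t
    rw [real_inner_comm, integralDeriv, ← integral_inner hψ]
    congr 1
    ext u
    rw [real_inner_smul_left, real_inner_smul_right]
    ring
  have e2 : ∀ z : ℝ × ℝ, deriv φ z.1 * deriv ψ z.2 * inner ℝ (hX.path z.1) (hX.path z.2) =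
      (1 / 2) * (deriv φ z.1 * ‖hX.path z.1‖ ^ 2 * deriv ψ z.2) +
      (1 / 2) * (deriv φ z.1 * (deriv ψ z.2 * ‖hX.path z.2‖ ^ 2)) +
      -(1 / 2) * (deriv φ z.1 * deriv ψ z.2 * |z.1 - z.2| ^ (2 * H)) := fun z => by
    rw [← hX.norm_path_sub_sq hH, norm_sub_sq_real]
    ring
  have hpow : Continuous fun z : ℝ × ℝ => |z.1 - z.2| ^ (2 * H) :=
    ((continuous_fst.sub continuous_snd).abs).rpow_const fun x => Or.inr (by positivity)
  have i1 : Integrable fun z : ℝ × ℝ => deriv φ z.1 * ‖hX.path z.1‖ ^ 2 * deriv ψ z.2 :=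
    (hi (fun z => ‖hX.path z.1‖ ^ 2) (by fun_prop)).congr
      (Filter.Eventually.of_forall fun z => by ring)
  have i2 : Integrable fun z : ℝ × ℝ => deriv φ z.1 * (deriv ψ z.2 * ‖hX.path z.2‖ ^ 2) :=
    (hi (fun z => ‖hX.path z.2‖ ^ 2) (by fun_prop)).congr
      (Filter.Eventually.of_forall fun z => by ring)
  have hin : Integrable (fun z : ℝ × ℝ =>
      deriv φ z.1 * deriv ψ z.2 * inner ℝ (hX.path z.1) (hX.path z.2))
      ((volume : Measure ℝ).prod volume) :=
    hi _ (by fun_prop)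
  rw [e1, integral_integral hin]
  simp_rw [e2]
  have i12 := (i1.const_mul (1 / 2)).add (i2.const_mul (1 / 2))
  simp only [Pi.add_def] at i12
  rw [← Measure.volume_eq_prod, integral_add i12 ((hi _ hpow).const_mul _), integral_add (i1.const_mul _) (i2.const_mul _),
    integral_const_mul, integral_const_mul, integral_const_mul, Measure.volume_eq_prod,
    integral_prod_mul (fun t => deriv φ t * ‖hX.path t‖ ^ 2),
    integral_prod_mul (deriv φ) (fun u => deriv ψ u * ‖hX.path u‖ ^ 2), φ.integral_deriv_eq_zero, ψ.integral_deriv_eq_zero]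
  ring

theorem inner_integralDeriv_eq (hH : H ∈ Set.Ioo (0 : ℝ) 1)
    (hX : IsFractionalBrownianMotion H X P) {I : Opens ℝ} (φ ψ : 𝓓(I, ℝ)) :
    inner ℝ (hX.integralDeriv φ) (hX.integralDeriv ψ) =
      Real.sin (Real.pi * H) * Real.Gamma (1 + 2 * H) *
        inner ℝ (testToHomSobolev (abs_half_sub_lt hH) φ)
          (testToHomSobolev (abs_half_sub_lt hH) ψ) := by
  rw [hX.inner_integralDeriv hH.1, integral_prod_mul_abs_sub_rpow hH φ.continuous_deriv
    ψ.continuous_deriv φ.hasCompactSupport.deriv ψ.hasCompactSupport.deriv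
    φ.integral_deriv_eq_zero, inner_testToHomSobolev]
  have := integral_re (integrable_unitaryFourier_mul_conj (abs_half_sub_lt hH)
    (testToSchwartz φ) (testToSchwartz ψ))
  rw [RCLike.re_to_complex] at this
  rw [← this, ← mul_assoc, ← integral_const_mul, ← integral_const_mul]
  refine integral_congr_ae ?_
  -- The origin is excluded because for H = 1/2 the weight there is 0 ^ 0 = 1, whereas the factor ξ
  -- ^ 2 vanishes.
  have h0 : ∀ᵐ x : ℝ, x ≠ 0 := by simp [ae_iff]
  filter_upwards [h0] with ξ hξ
  have e : |ξ| ^ (2 * (1 / 2 - H)) = ξ ^ 2 * |ξ| ^ (-1 - 2 * H) := by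
    rw [← sq_abs, ← Real.rpow_natCast, ← Real.rpow_add (abs_pos.2 hξ)]
    congr 1
    push_cast
    ring
  rw [RCLike.re_to_complex, Complex.re_mul_ofReal, re_unitaryFourier_mul_conj, e,
    φ.integral_deriv_mul_cos, φ.integral_deriv_mul_sin, ψ.integral_deriv_mul_cos,
    ψ.integral_deriv_mul_sin]
  have := Real.pi_pos
  field_simp
  ring

end IsFractionalBrownianMotion

noncomputable section

/-! ### The increments span the integrals against derivatives of test functions -/

open Metric in
theorem exists_testFunction_deriv_eq {I : Opens ℝ} {u v δ : ℝ}
    (hδ : cthickening δ (Set.uIcc v u) ⊆ I) (ρ : ContDiffBump (0 : ℝ)) (hρ : ρ.rOut ≤ δ) :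
    ∃ φ : 𝓓(I, ℝ), ∀ x, deriv φ x = ρ.normed volume (x - v) - ρ.normed volume (x - u) := by
  set f := ρ.normed volume with hf
  have hfc : Continuous f := ρ.continuous_normed
  -- The signed indicator of the segment from v to u, mollified; its derivative is the difference of
  -- the mollified Dirac masses at v and u.
  let F : ℝ → ℝ := fun x => ∫ y in v..u, f (x - y)
  have hF : ∀ x, HasDerivAt F (f (x - v) - f (x - u)) x := by
    intro x
    have e : F = fun x => (∫ z in (0 : ℝ)..(x - v), f z) - ∫ z in (0 : ℝ)..(x - u), f z := by
      ext x
      simp only [F]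
      rw [intervalIntegral.integral_comp_sub_left,
        intervalIntegral.integral_interval_sub_left (hfc.intervalIntegrable _ _)
          (hfc.intervalIntegrable _ _)]
    have h1 : ∀ w, HasDerivAt (fun x => ∫ z in (0 : ℝ)..(x - w), f z) (f (x - w)) x := fun w =>
      (hfc.integral_hasStrictDerivAt 0 (x - w)).hasDerivAt.comp_sub_const x w
    rw [e]
    exact (h1 v).sub (h1 u)
  have hd : deriv F = fun x => f (x - v) - f (x - u) := funext fun x => (hF x).deriv
  have hsm : ContDiff ℝ (⊤ : ℕ∞) F := by
    rw [contDiff_infty_iff_deriv, hd]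
    have hfs : ContDiff ℝ (⊤ : ℕ∞) f := ρ.contDiff_normed
    exact ⟨fun x => (hF x).differentiableAt, (hfs.comp (contDiff_id.sub contDiff_const)).sub
      (hfs.comp (contDiff_id.sub contDiff_const))⟩
  have hsupp : Function.support F ⊆ cthickening δ (Set.uIcc v u) := by
    intro x hx
    by_contra hn
    refine hx (intervalIntegral.integral_zero_ae (Filter.Eventually.of_forall fun y hy => ?_))
    by_contra hy0
    have h1 : x - y ∈ Function.support f := hy0
    rw [hf, ρ.support_normed_eq, mem_ball, dist_zero_right, Real.norm_eq_abs] at h1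
    refine hn (mem_cthickening_of_dist_le x y δ _ (Set.uIoc_subset_uIcc hy) ?_)
    rw [Real.dist_eq]
    exact h1.le.trans hρ
  have htsupp : tsupport F ⊆ cthickening δ (Set.uIcc v u) :=
    closure_minimal hsupp isClosed_cthickening
  exact ⟨⟨F, hsm, HasCompactSupport.of_support_subset_isCompact
    isCompact_uIcc.cthickening hsupp, htsupp.trans hδ⟩, fun x => congrFun hd x⟩

namespace IsFractionalBrownianMotion

variable {Ω : Type*} [MeasurableSpace Ω] {H : ℝ} {X : ℝ → Ω → ℝ} {P : Measure Ω}

/-- The map `φ ↦ ∫ φ'(t) X_t dt` on test functions supported in `I`. -/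
def integralDerivLin (hX : IsFractionalBrownianMotion H X P) (hH : 0 < H) (I : Opens ℝ) :
    𝓓(I, ℝ) →ₗ[ℝ] Lp ℝ 2 P where
  toFun := hX.integralDeriv
  map_add' φ ψ := by
    rw [integralDeriv, integralDeriv, integralDeriv,
      ← integral_add (hX.integrable_deriv_smul_path hH φ) (hX.integrable_deriv_smul_path hH ψ)]
    congr 1
    ext1 t
    have h : deriv ⇑(φ + ψ) t = deriv φ t + deriv ψ t :=
      ((φ.hasDerivAt t).add (ψ.hasDerivAt t)).deriv
    rw [h, add_smul]
  map_smul' c φ := by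
    rw [integralDeriv, integralDeriv, RingHom.id_apply, ← integral_smul]
    congr 1
    ext1 t
    have h : deriv ⇑(c • φ) t = c * deriv φ t := ((φ.hasDerivAt t).const_mul c).deriv
    rw [h, mul_smul]

theorem integralDerivLin_apply (hX : IsFractionalBrownianMotion H X P) (hH : 0 < H) {I : Opens ℝ}
    (φ : 𝓓(I, ℝ)) : hX.integralDerivLin hH I φ = hX.integralDeriv φ := rfl

/-- By mean-square continuity, mollifications of X at a point converge to its value there.
Order-connectedness puts the whole segment between u and v inside I, and by compactness a
δ-neighbourhood of it as well. -/
theorem path_sub_mem_closure (hX : IsFractionalBrownianMotion H X P) (hH : 0 < H) {I : Opens ℝ}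
    (hI : (I : Set ℝ).OrdConnected) {u v : ℝ} (hu : u ∈ I) (hv : v ∈ I) :
    hX.path u - hX.path v ∈ (LinearMap.range (hX.integralDerivLin hH I)).topologicalClosure := by
  obtain ⟨δ, hδ, hsub⟩ := (isCompact_uIcc (a := u) (b := v)).exists_cthickening_subset_open
    I.isOpen (hI.uIcc_subset hu hv)
  let ρ : ℕ → ContDiffBump (0 : ℝ) := fun n =>
    { rIn := δ / (n + 2), rOut := δ / (n + 1), rIn_pos := by positivity,
      rIn_lt_rOut := by gcongr; norm_num }
  have hlim : Filter.Tendsto (fun n => (ρ n).rOut) Filter.atTop (nhds 0) :=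
    tendsto_const_div_atTop_nhds_zero_nat δ |>.comp (Filter.tendsto_add_atTop_nat 1) |>.congr
      fun n => by simp [ρ]
  have hle : ∀ n, (ρ n).rOut ≤ δ := fun n => div_le_self hδ.le (by simp)
  -- The roles of u and v are exchanged here, so the derivative is the mollified mass at u minus the
  -- one at v.
  choose φ hφ using fun n => exists_testFunction_deriv_eq hsub (ρ n) (hle n)
  have hc := hX.continuous_path hH
  have key : ∀ w, Filter.Tendsto (fun n => ∫ t, (ρ n).normed volume (t - w) • hX.path t)
      Filter.atTop (nhds (hX.path w)) := fun w => by
    refine (ContDiffBump.convolution_tendsto_right_of_continuous (μ := volume) hlim hc w).congr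
      fun n => ?_
    rw [convolution_eq_swap]
    congr 1
    ext1 t
    rw [ContinuousLinearMap.lsmul_apply, ← (ρ n).normed_neg, neg_sub]
  have hi : ∀ n w, Integrable fun t => (ρ n).normed volume (t - w) • hX.path t := fun n w => by
    refine Continuous.integrable_of_hasCompactSupport (((ρ n).continuous_normed.comp
      (continuous_id.sub continuous_const)).smul hc) ?_
    exact ((ρ n).hasCompactSupport_normed.comp_homeomorph (Homeomorph.subRight w)).smul_right
  refine mem_closure_of_tendsto ((key u).sub (key v)) (Filter.Eventually.of_forall fun n => ?_)
  refine ⟨φ n, ?_⟩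
  change hX.integralDeriv (φ n) = _
  rw [integralDeriv, ← integral_sub (hi n u) (hi n v)]
  congr 1
  ext1 t
  rw [hφ, sub_smul]

/-- As φ' has mean zero, a fixed X_u with u in I may be subtracted from X_t under the integral. Any
y orthogonal to the closed space E_I then annihilates the integrand pointwise, so the integral lies
in the double orthogonal complement, which is E_I. -/
theorem integralDeriv_mem_incrementSpace (hX : IsFractionalBrownianMotion H X P) (hH : 0 < H)
    {I : Opens ℝ} (φ : 𝓓(I, ℝ)) : hX.integralDeriv φ ∈ hX.incrementSpace I := by
  have hcl : IsClosed (hX.incrementSpace I : Set (Lp ℝ 2 P)) :=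
    Submodule.isClosed_topologicalClosure _
  have := hcl.completeSpace_coe
  rw [← (hX.incrementSpace I).orthogonal_orthogonal, Submodule.mem_orthogonal]
  intro y hy
  -- This form of the choice covers empty I, where u = 0 and the condition is vacuous.
  obtain ⟨u, hu⟩ : ∃ u, ∀ t ∈ I, u ∈ I := by
    by_cases h : ∃ u, u ∈ I
    · exact ⟨h.choose, fun _ _ => h.choose_spec⟩
    · exact ⟨0, fun t ht => (h ⟨t, ht⟩).elim⟩
  have hi := hX.integrable_deriv_smul_path hH φ
  have hi2 : Integrable fun t => deriv φ t • hX.path u :=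
    (φ.continuous_deriv.integrable_of_hasCompactSupport φ.hasCompactSupport.deriv).smul_const _
  have e : hX.integralDeriv φ = ∫ t, (deriv φ t • hX.path t - deriv φ t • hX.path u) := by
    rw [integral_sub hi hi2, integral_smul_const, φ.integral_deriv_eq_zero, zero_smul, sub_zero,
      integralDeriv]
  have hi3 := hi.sub hi2
  simp only [Pi.sub_def] at hi3
  rw [e, ← integral_inner hi3]
  refine integral_eq_zero_of_ae (Filter.Eventually.of_forall fun t => ?_)
  beta_reduce
  rw [← smul_sub, real_inner_smul_right, Pi.zero_apply]
  by_cases ht : t ∈ I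
  · have hm : hX.path t - hX.path u ∈ hX.incrementSpace I :=
      Submodule.le_topologicalClosure _ (Submodule.subset_span ⟨t, ht, u, hu t ht, rfl⟩)
    rw [real_inner_comm, (Submodule.mem_orthogonal _ _).1 hy _ hm, mul_zero]
  · have h0 : deriv φ t = 0 := by
      by_contra hne
      exact ht (φ.tsupport_subset (support_deriv_subset hne))
    rw [h0, zero_mul]

theorem incrementSpace_eq_topologicalClosure (hX : IsFractionalBrownianMotion H X P) (hH : 0 < H)
    {I : Opens ℝ} (hI : (I : Set ℝ).OrdConnected) :
    hX.incrementSpace I = (LinearMap.range (hX.integralDerivLin hH I)).topologicalClosure := by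
  apply le_antisymm
  · refine Submodule.topologicalClosure_minimal _ (Submodule.span_le.2 ?_)
      (Submodule.isClosed_topologicalClosure _)
    rintro _ ⟨u, hu, v, hv, rfl⟩
    exact hX.path_sub_mem_closure hH hI hu hv
  · refine Submodule.topologicalClosure_minimal _ ?_ (Submodule.isClosed_topologicalClosure _)
    rintro _ ⟨φ, rfl⟩
    exact hX.integralDeriv_mem_incrementSpace hH φ

end IsFractionalBrownianMotion

end

/-! ### Duality of weighted spaces and completeness of the homogeneous Sobolev spaces -/

theorem integrable_homWeight_iff {s : ℝ} {E : Type*} [NormedAddCommGroup E] [NormedSpace ℝ E]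
    {f : ℝ → E} : Integrable f (homWeight s) ↔ Integrable fun ξ => |ξ| ^ (2 * s) • f ξ := by
  rw [homWeight, integrable_withDensity_iff_integrable_smul' (by fun_prop) (by simp)]
  refine integrable_congr (Filter.Eventually.of_forall fun ξ => ?_)
  beta_reduce
  rw [ENNReal.toReal_ofReal (by positivity)]

theorem integral_homWeight {s : ℝ} {E : Type*} [NormedAddCommGroup E] [NormedSpace ℝ E]
    (f : ℝ → E) : ∫ ξ, f ξ ∂(homWeight s) = ∫ ξ, |ξ| ^ (2 * s) • f ξ := by
  rw [homWeight, integral_withDensity_eq_integral_toReal_smul (by fun_prop) (by simp)]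
  congr 1
  ext ξ
  rw [ENNReal.toReal_ofReal (by positivity)]

theorem ae_ne_zero : ∀ᵐ ξ : ℝ, ξ ≠ 0 := by simp [ae_iff]

theorem abs_rpow_neg_mul_abs_rpow {ξ : ℝ} (hξ : ξ ≠ 0) (s : ℝ) :
    |ξ| ^ (2 * -s) * |ξ| ^ (2 * s) = 1 := by
  rw [← Real.rpow_add (abs_pos.2 hξ)]
  ring_nf
  exact Real.rpow_zero _

/-- Since |ξ|^(-2s) (|ξ|^(2s))² = |ξ|^(2s), multiplication by the weight passes between the spaces
of exponents s and -s; this makes them dual under ∫ f g dξ. -/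
theorem memLp_weight_smul {s : ℝ} {g : ℝ → ℂ} (hg : MemLp g 2 (homWeight s)) :
    MemLp (fun ξ => |ξ| ^ (2 * s) • g ξ) 2 (homWeight (-s)) := by
  have hac : homWeight (-s) ≪ homWeight s := (homWeight_ac _).trans (ac_homWeight _)
  have hw : Measurable fun ξ : ℝ => |ξ| ^ (2 * s) := by fun_prop
  have hm : AEStronglyMeasurable (fun ξ => |ξ| ^ (2 * s) • g ξ) (homWeight (-s)) :=
    hw.aestronglyMeasurable.smul (hg.1.mono_ac hac)
  rw [memLp_two_iff_integrable_sq_norm hm, integrable_homWeight_iff]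
  have := (memLp_two_iff_integrable_sq_norm hg.1).1 hg
  rw [integrable_homWeight_iff] at this
  refine this.congr ?_
  filter_upwards [ae_ne_zero] with ξ hξ
  have h := abs_rpow_neg_mul_abs_rpow hξ s
  rw [norm_smul, Real.norm_of_nonneg (by positivity), smul_eq_mul, smul_eq_mul]
  linear_combination (-(|ξ| ^ (2 * s)) * ‖g ξ‖ ^ 2) * h

theorem integrable_mul_of_memLp {s : ℝ} {f g : ℝ → ℂ} (hf : MemLp f 2 (homWeight (-s)))
    (hg : MemLp g 2 (homWeight s)) : Integrable fun ξ => f ξ * g ξ := by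
  have := integrable_homWeight_iff.1 (hf.integrable_mul (memLp_weight_smul hg))
  refine this.congr ?_
  filter_upwards [ae_ne_zero] with ξ hξ
  have h := abs_rpow_neg_mul_abs_rpow hξ s
  rw [Pi.mul_apply, mul_smul_comm, smul_smul, h, one_smul]

/-- The representative is |ξ|^(-2s) times the conjugate of f. It exhibits g ↦ ∫ f g as continuous on
the weighted space. -/
theorem exists_inner_eq_integral_mul {s : ℝ} {f : ℝ → ℂ} (hf : MemLp f 2 (homWeight (-s))) :
    ∃ k : Lp ℂ 2 (homWeight s), ∀ (g : ℝ → ℂ) (hg : MemLp g 2 (homWeight s)),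
      inner ℂ k (hg.toLp g) = ∫ ξ, f ξ * g ξ := by
  have hk : MemLp (fun ξ => |ξ| ^ (2 * -s) • star (f ξ)) 2 (homWeight s) := by
    simpa using memLp_weight_smul hf.star
  refine ⟨hk.toLp, fun g hg => ?_⟩
  have h1 : ∀ᵐ ξ ∂(homWeight s), inner ℂ (hk.toLp _ ξ) (hg.toLp _ ξ) =
      |ξ| ^ (2 * -s) • (f ξ * g ξ) := by
    filter_upwards [hk.coeFn_toLp, hg.coeFn_toLp] with ξ a b
    rw [a, b]
    simp
    ring
  rw [L2.inner_def, integral_congr_ae h1, integral_homWeight]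
  refine integral_congr_ae ?_
  filter_upwards [ae_ne_zero] with ξ hξ
  rw [smul_smul, mul_comm, abs_rpow_neg_mul_abs_rpow hξ s, one_smul]

/-- Continuity of the inverse is what lets a tempered distribution be pulled back along it. -/
theorem exists_unitaryFourier_leftInverse :
    ∃ L : 𝓢(ℝ, ℂ) →L[ℂ] 𝓢(ℝ, ℂ), ∀ ψ, L (unitaryFourier ψ) = ψ := by
  have hc : (((√(2 * Real.pi))⁻¹ : ℝ) : ℂ) ≠ 0 := by
    have : (√(2 * Real.pi))⁻¹ ≠ 0 := by positivity
    exact_mod_cast this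
  refine ⟨(((√(2 * Real.pi))⁻¹ : ℝ) : ℂ)⁻¹ • ((FourierTransform.fourierInvCLM ℂ 𝓢(ℝ, ℂ)).comp
    (SchwartzMap.compCLMOfContinuousLinearEquiv ℂ frequencyScale.symm)), fun ψ => ?_⟩
  have h : SchwartzMap.compCLMOfContinuousLinearEquiv ℂ frequencyScale.symm (unitaryFourier ψ) =
      (((√(2 * Real.pi))⁻¹ : ℝ) : ℂ) • 𝓕 ψ := by
    ext ξ
    have h2 : frequencyScale.symm ξ * (2 * Real.pi)⁻¹ = ξ := frequencyScale.apply_symm_apply ξ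
    rw [SchwartzMap.compCLMOfContinuousLinearEquiv_apply, Function.comp_apply, unitaryFourier_eq,
      h2, smul_apply, smul_eq_mul]
  rw [smul_apply, ContinuousLinearMap.comp_apply, h, map_smul,
    inv_smul_smul₀ hc, FourierTransform.fourierInvCLM_apply,
    FourierTransform.fourierInv_fourier_eq]

theorem locallyIntegrable_of_integrable_schwartz_mul {g : ℝ → ℂ}
    (hg : ∀ ψ : 𝓢(ℝ, ℂ), Integrable fun ξ => ψ ξ * g ξ) : LocallyIntegrable g := by
  intro x
  let ρ : ContDiffBump x := ⟨1, 2, one_pos, one_lt_two⟩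
  have hc : HasCompactSupport (fun y => (ρ y : ℂ)) :=
    ρ.hasCompactSupport.comp_left Complex.ofReal_zero
  have hs : ContDiff ℝ (⊤ : ℕ∞) (fun y => (ρ y : ℂ)) := Complex.ofRealCLM.contDiff.comp ρ.contDiff
  refine ⟨Metric.closedBall x 1, Metric.closedBall_mem_nhds x one_pos, ?_⟩
  refine (hg (hc.toSchwartzMap hs)).integrableOn.congr_fun (fun y hy => ?_)
    Metric.isClosed_closedBall.measurableSet
  have h1 : ρ y = 1 := ρ.one_of_mem_closedBall hy
  simp [h1]

/-- The functional ψ ↦ ∫ ψ g is integration of |ξ|^(2s) g against |ξ|^(-2s) dξ, a measure of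
temperate growth since |s| < 1/2. It is therefore a tempered distribution, and precomposing with the
inverse transform gives f. -/
theorem exists_hasFourierDensity {s : ℝ} (hs : |s| < 1 / 2) {g : ℝ → ℂ}
    (hg : MemLp g 2 (homWeight s)) : ∃ f : 𝓢'(ℝ, ℂ), HasFourierDensity f g := by
  have hs' : |-s| < 1 / 2 := by rwa [abs_neg]
  have := homWeight_hasTemperateGrowth hs'
  obtain ⟨L, hL⟩ := exists_unitaryFourier_leftInverse
  have hi : ∀ ψ : 𝓢(ℝ, ℂ), Integrable fun ξ => ψ ξ * g ξ := fun ψ =>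
    integrable_mul_of_memLp (ψ.memLp 2 _) hg
  obtain ⟨h, hh⟩ : ∃ h : Lp ℂ 2 (homWeight (-s)),
      h =ᵐ[homWeight (-s)] fun ξ => |ξ| ^ (2 * s) • g ξ :=
    ⟨_, (memLp_weight_smul hg).coeFn_toLp⟩
  refine ⟨PointwiseConvergenceCLM.precomp ℂ L (Lp.toTemperedDistribution h),
    locallyIntegrable_of_integrable_schwartz_mul hi, fun ψ => ⟨hi ψ, ?_⟩⟩
  rw [PointwiseConvergenceCLM.precomp_apply]
  change Lp.toTemperedDistribution h (L (unitaryFourier ψ)) = _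
  rw [hL, Lp.toTemperedDistribution_apply]
  have h1 : ∀ᵐ ξ ∂(homWeight (-s)), ψ ξ • h ξ = |ξ| ^ (2 * s) • (ψ ξ * g ξ) := by
    filter_upwards [hh] with ξ a
    rw [a, smul_eq_mul, mul_smul_comm]
  rw [integral_congr_ae h1, integral_homWeight]
  refine integral_congr_ae ?_
  filter_upwards [ae_ne_zero] with ξ hξ
  rw [smul_smul, abs_rpow_neg_mul_abs_rpow hξ s, one_smul]

namespace HomSobolev

theorem isometry_fourierLin (s : ℝ) : Isometry (fourierLin s) :=
  AddMonoidHomClass.isometry_of_norm _ fun _ => rfl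

/-- The transforms of a Cauchy sequence converge in the weighted L² space, and the limit is the
transform of some f. Reality passes to f because f(ψ̂) is a continuous function of the transform. -/
theorem completeSpace {s : ℝ} (hs : |s| < 1 / 2) : CompleteSpace (HomSobolev s) := by
  have hs' : |-s| < 1 / 2 := by rwa [abs_neg]
  have := homWeight_hasTemperateGrowth hs'
  refine Metric.complete_of_cauchySeq_tendsto fun u hu => ?_
  obtain ⟨G, hG⟩ := cauchySeq_tendsto_of_complete
    ((isometry_fourierLin s).uniformContinuous.comp_cauchySeq hu)
  obtain ⟨f, hf⟩ := exists_hasFourierDensity hs (Lp.memLp G)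
  have hreal : IsRealDistribution f := by
    intro χ hχ
    obtain ⟨ψ, rfl⟩ := unitaryFourier_surjective χ
    obtain ⟨k, hk⟩ := exists_inner_eq_integral_mul (s := s) (ψ.memLp 2 (homWeight (-s)))
    have e : f (unitaryFourier ψ) = inner ℂ k G := by
      rw [(hf.2 ψ).2, ← hk _ (Lp.memLp G), Lp.toLp_coeFn]
    have e2 : ∀ n, toDistribution (u n) (unitaryFourier ψ) = inner ℂ k (fourierLin s (u n)) := by
      intro n
      obtain ⟨g, hg, hg2⟩ := (u n).exists_density
      have : fourierLin s (u n) = hg2.toLp := fourierLp_eq _ hg hg2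
      rw [this, hk, (hg.2 ψ).2]
    have hlim : Filter.Tendsto (fun n => (inner ℂ k (fourierLin s (u n))).im) Filter.atTop
        (nhds (inner ℂ k G).im) :=
      (Complex.continuous_im.tendsto _).comp ((tendsto_const_nhds (x := k)).inner hG)
    rw [e]
    refine tendsto_nhds_unique hlim (tendsto_const_nhds.congr fun n => ?_)
    rw [← e2]
    exact ((u n).2.1 _ hχ).symm
  let F : HomSobolev s := ⟨f, hreal, G, hf, Lp.memLp G⟩
  have hF : fourierLin s F = G := by
    have : fourierLin s F = (Lp.memLp G).toLp := fourierLp_eq F hf _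
    rw [this, Lp.toLp_coeFn]
  refine ⟨F, (isometry_fourierLin s).isEmbedding.tendsto_nhds_iff.2 ?_⟩
  rw [hF]
  exact hG

end HomSobolev

/-! ### Density of the test functions -/

theorem exists_testFunction_comp (φ : 𝓓((⊤ : Opens ℝ), ℝ)) (e : ℝ ≃ₜ ℝ)
    (he : ContDiff ℝ (⊤ : ℕ∞) e) : ∃ ψ : 𝓓((⊤ : Opens ℝ), ℝ), ∀ x, ψ x = φ (e x) :=
  ⟨⟨φ ∘ e, φ.contDiff.comp he, φ.hasCompactSupport.comp_homeomorph e, fun _ _ => trivial⟩,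
    fun _ => rfl⟩

theorem unitaryFourier_test_neg {φ ψ : 𝓓((⊤ : Opens ℝ), ℝ)} (h : ∀ x, ψ x = φ (-x)) (ξ : ℝ) :
    unitaryFourier (testToSchwartz ψ) ξ =
      (starRingEnd ℂ) (unitaryFourier (testToSchwartz φ) ξ) := by
  have h1 : ∫ t, ψ t * Real.cos (t * ξ) = ∫ t, φ t * Real.cos (t * ξ) := by
    rw [← integral_neg_eq_self]
    simp [h]
  have h2 : ∫ t, ψ t * Real.sin (t * ξ) = -∫ t, φ t * Real.sin (t * ξ) := by
    rw [← integral_neg_eq_self, ← integral_neg]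
    simp [h]
  rw [unitaryFourier_test, unitaryFourier_test, h1, h2]
  simp

theorem unitaryFourier_test_conj {I : Opens ℝ} (φ : 𝓓(I, ℝ)) (ξ : ℝ) :
    unitaryFourier (testToSchwartz φ) (-ξ) =
      (starRingEnd ℂ) (unitaryFourier (testToSchwartz φ) ξ) := by
  rw [unitaryFourier_test, unitaryFourier_test]
  simp [integral_neg]

theorem unitaryFourier_test_sub {φ ψ : 𝓓((⊤ : Opens ℝ), ℝ)} {v : ℝ} (h : ∀ x, ψ x = φ (x - v))
    (ξ : ℝ) : unitaryFourier (testToSchwartz ψ) ξ =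
      Complex.exp (-(Complex.I * v * ξ)) * unitaryFourier (testToSchwartz φ) ξ := by
  rw [unitaryFourier_apply, unitaryFourier_apply, mul_left_comm]
  refine congrArg _ ?_
  rw [← integral_sub_right_eq_self (fun x : ℝ => Complex.exp (-(Complex.I * x * ξ)) *
    testToSchwartz φ x) v, ← integral_const_mul]
  refine integral_congr_ae (Filter.Eventually.of_forall fun x => ?_)
  beta_reduce
  rw [testToSchwartz_apply, testToSchwartz_apply, h, ← mul_assoc, ← Complex.exp_add]
  congr 2
  push_cast
  ring

/-- The Fourier transform of a real-valued distribution is hermitian. -/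
theorem HasFourierDensity.ae_neg_eq_conj {f : 𝓢'(ℝ, ℂ)} {g : ℝ → ℂ} (h : HasFourierDensity f g)
    (hf : IsRealDistribution f) : ∀ᵐ ξ, g (-ξ) = (starRingEnd ℂ) (g ξ) := by
  have hneg : LocallyIntegrable fun ξ => g (-ξ) := by
    rw [locallyIntegrable_iff]
    intro K hK
    have := (h.1.integrableOn_isCompact hK.neg).comp_neg
    simpa using this
  have hconj : LocallyIntegrable fun ξ => (starRingEnd ℂ) (g ξ) := by
    rw [locallyIntegrable_iff]
    intro K hK
    exact Complex.conjCLE.toContinuousLinearMap.integrable_comp (h.1.integrableOn_isCompact hK)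
  refine ae_eq_of_integral_contDiff_smul_eq hneg hconj fun u hu hc => ?_
  let φ : 𝓓((⊤ : Opens ℝ), ℝ) := ⟨u, hu, hc, fun _ _ => trivial⟩
  obtain ⟨ψ, hψ⟩ := exists_testFunction_comp φ (Homeomorph.neg ℝ) contDiff_neg
  have hφψ := unitaryFourier_test_neg hψ
  have e1 : ∫ ξ, u ξ • g (-ξ) = f (unitaryFourier (testToSchwartz ψ)) := by
    rw [(h.2 _).2, ← integral_neg_eq_self]
    congr 1
    ext ξ
    rw [testToSchwartz_apply, hψ, neg_neg, Complex.real_smul]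
    rfl
  have e2 : ∫ ξ, u ξ • (starRingEnd ℂ) (g ξ) =
      (starRingEnd ℂ) (f (unitaryFourier (testToSchwartz φ))) := by
    rw [(h.2 _).2, ← integral_conj]
    congr 1
    ext ξ
    rw [testToSchwartz_apply, map_mul, Complex.conj_ofReal, Complex.real_smul]
    rfl
  rw [e1, e2]
  -- As ψ̂ is the conjugate of φ̂, both φ̂ + ψ̂ and i(φ̂ - ψ̂) are real-valued. Reality of f on them
  -- says that f(ψ̂) is the conjugate of f(φ̂).
  have r1 := hf (unitaryFourier (testToSchwartz φ) + unitaryFourier (testToSchwartz ψ)) fun x => by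
    rw [add_apply, hφψ]
    simp
  have r2 := hf (Complex.I • (unitaryFourier (testToSchwartz φ) -
      unitaryFourier (testToSchwartz ψ))) fun x => by
    rw [smul_apply, sub_apply, hφψ]
    simp
  rw [map_add] at r1
  rw [map_smul, map_sub] at r2
  apply Complex.ext
  · simp at r1 r2 ⊢
    linarith
  · simp at r1 r2 ⊢
    linarith

/-- Every test function is some ψ̂, and by Fubini ∫ ψ̂ m is an integral of ψ against the vanishing
transform of m. -/
theorem ae_eq_zero_of_integral_exp_mul_eq_zero {m : ℝ → ℂ} (hm : Integrable m)
    (h : ∀ v : ℝ, ∫ ξ : ℝ, Complex.exp (Complex.I * v * ξ) * m ξ = 0) : m =ᵐ[volume] 0 := by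
  refine ae_eq_zero_of_integral_contDiff_smul_eq_zero hm.locallyIntegrable fun u hu hc => ?_
  have hc' : HasCompactSupport (fun x => (u x : ℂ)) := hc.comp_left Complex.ofReal_zero
  have hu' : ContDiff ℝ (⊤ : ℕ∞) (fun x => (u x : ℂ)) := Complex.ofRealCLM.contDiff.comp hu
  obtain ⟨ψ, hψ⟩ := unitaryFourier_surjective (hc'.toSchwartzMap hu')
  have e1 : ∀ ξ, u ξ • m ξ = ∫ x : ℝ, (((√(2 * Real.pi))⁻¹ : ℝ) : ℂ) *
      (Complex.exp (-(Complex.I * x * ξ)) * ψ x * m ξ) := fun ξ => by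
    have : (u ξ : ℂ) = unitaryFourier ψ ξ := by
      rw [hψ]
      rfl
    rw [Complex.real_smul, this, unitaryFourier_apply, integral_const_mul, integral_mul_const,
      mul_assoc]
  simp_rw [e1]
  rw [integral_integral_swap]
  · refine integral_eq_zero_of_ae (Filter.Eventually.of_forall fun x => ?_)
    have e2 : ∀ ξ : ℝ, (((√(2 * Real.pi))⁻¹ : ℝ) : ℂ) *
        (Complex.exp (-(Complex.I * x * ξ)) * ψ x * m ξ) = (((√(2 * Real.pi))⁻¹ : ℝ) : ℂ) * ψ x *
          (Complex.exp (Complex.I * (-x : ℝ) * ξ) * m ξ) := fun ξ => by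
      push_cast
      ring_nf
    simp_rw [e2]
    rw [integral_const_mul, h, mul_zero, Pi.zero_apply]
  · refine Integrable.const_mul ?_ _
    have hp : Integrable (fun z : ℝ × ℝ => m z.1 * ψ z.2) (volume.prod volume) :=
      hm.mul_prod (ψ.integrable)
    have hb : ∀ z : ℝ × ℝ, ‖Complex.exp (-(Complex.I * z.2 * z.1))‖ ≤ 1 := fun z => by
      rw [Complex.norm_exp]
      simp
    refine (hp.bdd_mul (c := 1) (f := fun z : ℝ × ℝ => Complex.exp (-(Complex.I * z.2 * z.1)))
      (Continuous.aestronglyMeasurable (by fun_prop)) (Filter.Eventually.of_forall hb)).congr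
      (Filter.Eventually.of_forall fun z => ?_)
    simp only
    ring

/-- A sequence of test functions whose Fourier transforms tend to a nonzero constant. -/
theorem exists_testFunction_tendsto_unitaryFourier : ∃ φ : ℕ → 𝓓((⊤ : Opens ℝ), ℝ), ∀ ξ,
    Filter.Tendsto (fun n => unitaryFourier (testToSchwartz (φ n)) ξ) Filter.atTop
      (nhds (((√(2 * Real.pi))⁻¹ : ℝ) : ℂ)) := by
  let ρ : ℕ → ContDiffBump (0 : ℝ) := fun n =>
    { rIn := 1 / (n + 2), rOut := 1 / (n + 1), rIn_pos := by positivity,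
      rIn_lt_rOut := by gcongr; norm_num }
  have hlim : Filter.Tendsto (fun n => (ρ n).rOut) Filter.atTop (nhds 0) :=
    tendsto_one_div_add_atTop_nhds_zero_nat
  refine ⟨fun n => ⟨(ρ n).normed volume, (ρ n).contDiff_normed, (ρ n).hasCompactSupport_normed,
    fun _ _ => trivial⟩, fun ξ => ?_⟩
  have hc : Continuous fun x : ℝ => Complex.exp (Complex.I * x * ξ) := by fun_prop
  have := (ContDiffBump.convolution_tendsto_right_of_continuous (μ := volume) hlim hc 0).const_mul
    (((√(2 * Real.pi))⁻¹ : ℝ) : ℂ)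
  simp only [Complex.ofReal_zero, mul_zero, zero_mul, Complex.exp_zero, mul_one] at this
  refine this.congr fun n => ?_
  rw [unitaryFourier_apply]
  congr 1
  refine integral_congr_ae (Filter.Eventually.of_forall fun x => ?_)
  beta_reduce
  rw [testToSchwartz_apply, ContinuousLinearMap.lsmul_apply, Complex.real_smul, mul_comm]
  congr 2
  push_cast
  ring

namespace HomSobolev

theorem inner_test_eq {s : ℝ} (hs : |s| < 1 / 2) {I : Opens ℝ} (φ : 𝓓(I, ℝ)) (f : HomSobolev s)
    {g : ℝ → ℂ} (hg : HasFourierDensity (toDistribution f) g) (hg2 : MemLp g 2 (homWeight s)) :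
    Integrable (fun ξ => |ξ| ^ (2 * s) •
      ((starRingEnd ℂ) (unitaryFourier (testToSchwartz φ) ξ) * g ξ)) ∧
    inner ℝ (testToHomSobolev hs φ) f = (∫ ξ, |ξ| ^ (2 * s) •
      ((starRingEnd ℂ) (unitaryFourier (testToSchwartz φ) ξ) * g ξ)).re := by
  have h1 := memLp_unitaryFourier hs (testToSchwartz φ)
  have e1 : fourierLin s (testToHomSobolev hs φ) = h1.toLp :=
    fourierLp_eq _ (hasFourierDensity_test φ) _
  have e2 : fourierLin s f = hg2.toLp := fourierLp_eq f hg hg2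
  have hi : Integrable (fun ξ => (starRingEnd ℂ) (unitaryFourier (testToSchwartz φ) ξ) * g ξ)
      (homWeight s) := h1.star.integrable_mul hg2
  refine ⟨integrable_homWeight_iff.1 hi, ?_⟩
  change inner ℝ (fourierLin s _) (fourierLin s _) = _
  have : ∀ᵐ ξ ∂(homWeight s), inner ℝ (h1.toLp _ ξ) (hg2.toLp _ ξ) =
      RCLike.re ((starRingEnd ℂ) (unitaryFourier (testToSchwartz φ) ξ) * g ξ) := by
    filter_upwards [h1.coeFn_toLp, hg2.coeFn_toLp] with ξ a b
    rw [a, b]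
    simp [Complex.inner]
    ring
  rw [e1, e2, L2.inner_def, integral_congr_ae this, integral_re hi, integral_homWeight,
    RCLike.re_to_complex]

/-- Let m be |ξ|^(2s) times g and the conjugate of φ̂. It is hermitian, so its integral is real and
vanishes with the real inner product. Translating φ by v multiplies m by e^(ivξ), so the whole
Fourier transform of m vanishes and m = 0 almost everywhere. -/
theorem eq_zero_of_forall_inner_test_eq_zero {s : ℝ} (hs : |s| < 1 / 2) (f : HomSobolev s)
    (hf : ∀ φ : 𝓓((⊤ : Opens ℝ), ℝ), inner ℝ (testToHomSobolev hs φ) f = 0) : f = 0 := by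
  obtain ⟨g, hg, hg2⟩ := f.exists_density
  have hherm := hg.ae_neg_eq_conj f.2.1
  let m : 𝓓((⊤ : Opens ℝ), ℝ) → ℝ → ℂ := fun φ ξ =>
    |ξ| ^ (2 * s) • ((starRingEnd ℂ) (unitaryFourier (testToSchwartz φ) ξ) * g ξ)
  have hm0 : ∀ φ, ∫ ξ, m φ ξ = 0 := fun φ => by
    apply Complex.ext
    · rw [Complex.zero_re, ← hf φ, (inner_test_eq hs φ f hg hg2).2]
    · have : ∫ ξ, m φ ξ = (starRingEnd ℂ) (∫ ξ, m φ ξ) := by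
        conv_lhs => rw [← integral_neg_eq_self]
        rw [← integral_conj]
        refine integral_congr_ae ?_
        filter_upwards [hherm] with ξ hξ
        simp only [m, abs_neg, hξ, unitaryFourier_test_conj, Complex.real_smul, map_mul,
          Complex.conj_ofReal]
      rw [Complex.zero_im]
      exact Complex.conj_eq_iff_im.1 this.symm
  have hmz : ∀ φ, m φ =ᵐ[volume] 0 := fun φ => by
    refine ae_eq_zero_of_integral_exp_mul_eq_zero (inner_test_eq hs φ f hg hg2).1 fun v => ?_
    obtain ⟨ψ, hψ⟩ := exists_testFunction_comp φ (Homeomorph.subRight v)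
      (contDiff_id.sub contDiff_const)
    rw [← hm0 ψ]
    refine integral_congr_ae (Filter.Eventually.of_forall fun ξ => ?_)
    simp only [m]
    rw [unitaryFourier_test_sub hψ, map_mul, ← Complex.exp_conj, mul_smul_comm, mul_assoc]
    simp [mul_assoc]
  obtain ⟨φ, hφ⟩ := exists_testFunction_tendsto_unitaryFourier
  have hgz : g =ᵐ[homWeight s] 0 := by
    refine (homWeight_ac s).ae_eq ?_
    -- Countably many test functions suffice to cancel φ̂, so the exceptional null sets can be
    -- united.
    filter_upwards [ae_all_iff.2 fun n => hmz (φ n), ae_ne_zero] with ξ hξ hξ0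
    have hc : (((√(2 * Real.pi))⁻¹ : ℝ) : ℂ) ≠ 0 := by
      have : (√(2 * Real.pi))⁻¹ ≠ 0 := by positivity
      exact_mod_cast this
    obtain ⟨n, hn⟩ := ((hφ ξ).eventually_ne hc).exists
    have hw : |ξ| ^ (2 * s) ≠ 0 := (Real.rpow_pos_of_pos (abs_pos.2 hξ0) _).ne'
    have := hξ n
    simp only [m, Pi.zero_apply, smul_eq_zero, mul_eq_zero, map_eq_zero, hw, hn, false_or] at this
    exact this
  refine fourierLin_injective s ?_
  rw [map_zero]
  change fourierLp f = 0
  rw [fourierLp_eq f hg hg2]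
  exact (MemLp.toLp_eq_toLp_iff hg2 MemLp.zero).2 hgz

end HomSobolev

noncomputable section

/-! ### The isometry between increments and the homogeneous Sobolev space -/

theorem exists_linearIsometry_of_norm_eq {V E F : Type*} [AddCommGroup V] [Module ℝ V]
    [NormedAddCommGroup E] [NormedSpace ℝ E] [NormedAddCommGroup F] [NormedSpace ℝ F]
    [CompleteSpace F] (f : V →ₗ[ℝ] F) (e : V →ₗ[ℝ] E) (he : DenseRange e)
    (h : ∀ x, ‖f x‖ = ‖e x‖) : ∃ L : E →ₗᵢ[ℝ] F, ∀ x, L (e x) = f x := by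
  have hB : ∀ x, f.extendOfNorm e (e x) = f x :=
    LinearMap.extendOfNorm_eq he ⟨1, fun x => by rw [h, one_mul]⟩
  refine ⟨⟨(f.extendOfNorm e).toLinearMap, fun w => ?_⟩, hB⟩
  refine he.induction_on (p := fun w => ‖f.extendOfNorm e w‖ = ‖w‖) w
    (isClosed_eq (by fun_prop) (by fun_prop)) fun x => ?_
  rw [hB, h]

/-- The embedding of the test functions supported in `I` into `W̃^(s,2)(ℝ)`. -/
def testLin {s : ℝ} (hs : |s| < 1 / 2) (I : Opens ℝ) : 𝓓(I, ℝ) →ₗ[ℝ] HomSobolev s where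
  toFun := testToHomSobolev hs
  map_add' φ ψ := by
    have h : testToSchwartz (φ + ψ) = testToSchwartz φ + testToSchwartz ψ := by
      ext x
      exact Complex.ofReal_add (φ x) (ψ x)
    apply HomSobolev.toDistribution_injective
    change SchwartzMap.toTemperedDistributionCLM ℝ ℂ volume (testToSchwartz (φ + ψ)) = _
    rw [h, map_add, map_add]
    rfl
  map_smul' c φ := by
    have h : testToSchwartz (c • φ) = (c : ℂ) • testToSchwartz φ := by
      ext x
      exact Complex.ofReal_mul c (φ x)
    apply HomSobolev.toDistribution_injective
    change SchwartzMap.toTemperedDistributionCLM ℝ ℂ volume (testToSchwartz (c • φ)) = _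
    rw [h, map_smul, map_smul]
    rfl

theorem testLin_apply {s : ℝ} (hs : |s| < 1 / 2) {I : Opens ℝ} (φ : 𝓓(I, ℝ)) :
    testLin hs I φ = testToHomSobolev hs φ := rfl

theorem denseRange_testLin {s : ℝ} (hs : |s| < 1 / 2) :
    DenseRange (testLin hs (⊤ : Opens ℝ)) := by
  have := HomSobolev.completeSpace hs
  have h : (LinearMap.range (testLin hs (⊤ : Opens ℝ))).topologicalClosure = ⊤ := by
    rw [Submodule.topologicalClosure_eq_top_iff, Submodule.eq_bot_iff]
    intro f hf
    refine HomSobolev.eq_zero_of_forall_inner_test_eq_zero hs f fun φ => ?_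
    exact (Submodule.mem_orthogonal _ _).1 hf _ ⟨φ, rfl⟩
  have h2 := (Submodule.dense_iff_topologicalClosure_eq_top).2 h
  rwa [LinearMap.coe_range] at h2

namespace IsFractionalBrownianMotion

variable {Ω : Type*} [MeasurableSpace Ω] {H : ℝ} {X : ℝ → Ω → ℝ} {P : Measure Ω}

theorem norm_integralDeriv (hH : H ∈ Set.Ioo (0 : ℝ) 1) (hX : IsFractionalBrownianMotion H X P)
    {I : Opens ℝ} (φ : 𝓓(I, ℝ)) : ‖hX.integralDeriv φ‖ =
      √(Real.sin (Real.pi * H) * Real.Gamma (1 + 2 * H)) *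
        ‖testToHomSobolev (abs_half_sub_lt hH) φ‖ := by
  have h := hX.inner_integralDeriv_eq hH φ φ
  rw [real_inner_self_eq_norm_sq, real_inner_self_eq_norm_sq] at h
  rw [← Real.sqrt_sq (norm_nonneg (hX.integralDeriv φ)), h,
    Real.sqrt_mul (sin_mul_Gamma_pos hH).le, Real.sqrt_sq (norm_nonneg _)]

/-- The extension starts from the Sobolev side, where the test functions are dense, and lands in the
complete space L²(P). -/
theorem exists_linearIsometry_integralDeriv (hH : H ∈ Set.Ioo (0 : ℝ) 1)
    (hX : IsFractionalBrownianMotion H X P) : ∃ L : HomSobolev (1 / 2 - H) →ₗᵢ[ℝ] Lp ℝ 2 P,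
      ∀ (I : Opens ℝ) (φ : 𝓓(I, ℝ)), L (testToHomSobolev (abs_half_sub_lt hH) φ) =
        (√(Real.sin (Real.pi * H) * Real.Gamma (1 + 2 * H)))⁻¹ • hX.integralDeriv φ := by
  have ha := Real.sqrt_pos.2 (sin_mul_Gamma_pos hH)
  generalize hκ : √(Real.sin (Real.pi * H) * Real.Gamma (1 + 2 * H)) = κ at ha
  have hnorm : ∀ φ : 𝓓((⊤ : Opens ℝ), ℝ), ‖(κ⁻¹ • hX.integralDerivLin hH.1 ⊤) φ‖ =
      ‖testLin (abs_half_sub_lt hH) ⊤ φ‖ := fun φ => by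
    rw [LinearMap.smul_apply, integralDerivLin_apply, testLin_apply, norm_smul,
      hX.norm_integralDeriv hH, hκ, Real.norm_of_nonneg (by positivity),
      inv_mul_cancel_left₀ ha.ne']
  obtain ⟨L, hL⟩ := exists_linearIsometry_of_norm_eq _ _
    (denseRange_testLin (abs_half_sub_lt hH)) hnorm
  refine ⟨L, fun I φ => ?_⟩
  -- A test function on I is read as one on the whole line; neither its integral nor its
  -- distribution depends on I.
  have := hL ⟨φ, φ.contDiff, φ.hasCompactSupport, fun _ _ => trivial⟩
  rwa [LinearMap.smul_apply, integralDerivLin_apply, testLin_apply] at this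

theorem image_homSobolevZero (hH : H ∈ Set.Ioo (0 : ℝ) 1)
    (hX : IsFractionalBrownianMotion H X P) {L : HomSobolev (1 / 2 - H) →ₗᵢ[ℝ] Lp ℝ 2 P}
    (hL : ∀ (I : Opens ℝ) (φ : 𝓓(I, ℝ)), L (testToHomSobolev (abs_half_sub_lt hH) φ) =
      (√(Real.sin (Real.pi * H) * Real.Gamma (1 + 2 * H)))⁻¹ • hX.integralDeriv φ)
    {I : Opens ℝ} (hI : (I : Set ℝ).OrdConnected) :
    L '' homSobolevZero (abs_half_sub_lt hH) I = hX.incrementSpace I := by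
  have := HomSobolev.completeSpace (abs_half_sub_lt hH)
  have ha := Real.sqrt_pos.2 (sin_mul_Gamma_pos hH)
  -- An isometry from a complete space is a closed embedding, so images commute with closures.
  rw [homSobolevZero, ← L.isometry.isClosedEmbedding.closure_image_eq,
    hX.incrementSpace_eq_topologicalClosure hH.1 hI, Submodule.topologicalClosure_coe]
  congr 1
  ext Z
  constructor
  · rintro ⟨_, ⟨φ, rfl⟩, rfl⟩
    rw [hL]
    exact Submodule.smul_mem _ _ ⟨φ, rfl⟩
  · rintro ⟨φ, rfl⟩
    refine ⟨_, ⟨√(Real.sin (Real.pi * H) * Real.Gamma (1 + 2 * H)) • φ, rfl⟩, ?_⟩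
    rw [hL]
    rw [← integralDerivLin_apply hX hH.1, map_smul, inv_smul_smul₀ ha.ne']

end IsFractionalBrownianMotion

end

theorem corollary4p2 {Ω : Type*} [MeasurableSpace Ω] {P : Measure Ω} [IsProbabilityMeasure P]
    {H : ℝ} (hH : H ∈ Set.Ioo (0 : ℝ) 1) {X : ℝ → Ω → ℝ} (hX : IsFractionalBrownianMotion H X P) :
    0 < Real.sin (Real.pi * H) * Real.Gamma (1 + 2 * H) ∧
    (∀ φ₁ φ₂ : 𝓓((⊤ : Opens ℝ), ℝ),
      ∫ ω, hX.integralDeriv φ₁ ω * hX.integralDeriv φ₂ ω ∂P =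
        Real.sin (Real.pi * H) * Real.Gamma (1 + 2 * H) *
          inner ℝ (testToHomSobolev (abs_half_sub_lt hH) φ₁)
            (testToHomSobolev (abs_half_sub_lt hH) φ₂)) ∧
    ∃ J : hX.incrementSpace Set.univ ≃ₗᵢ[ℝ] HomSobolev (1 / 2 - H),
      (∀ φ : 𝓓((⊤ : Opens ℝ), ℝ), ∃ h : hX.integralDeriv φ ∈ hX.incrementSpace Set.univ,
        J ⟨hX.integralDeriv φ, h⟩ = √(Real.sin (Real.pi * H) * Real.Gamma (1 + 2 * H)) •
          testToHomSobolev (abs_half_sub_lt hH) φ) ∧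
      ∀ I : Opens ℝ, (I : Set ℝ).OrdConnected →
        J '' {Z | (Z : Lp ℝ 2 P) ∈ hX.incrementSpace I} =
          homSobolevZero (abs_half_sub_lt hH) I := by
  have ha := Real.sqrt_pos.2 (sin_mul_Gamma_pos hH)
  refine ⟨sin_mul_Gamma_pos hH, fun φ₁ φ₂ => ?_, ?_⟩
  · rw [← hX.inner_integralDeriv_eq hH, L2.inner_def]
    congr 1
    ext ω
    exact mul_comm _ _
  obtain ⟨L, hL⟩ := hX.exists_linearIsometry_integralDeriv hH
  have himage : ∀ I : Opens ℝ, (I : Set ℝ).OrdConnected →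
      L '' homSobolevZero (abs_half_sub_lt hH) I = hX.incrementSpace I :=
    fun I hI => hX.image_homSobolevZero hH hL hI
  -- Surjectivity onto the full increment space is the case I = ℝ, where density makes the closure
  -- of the test functions everything.
  have hrange : L.toLinearMap.range = hX.incrementSpace Set.univ := by
    have h1 := himage ⊤ Set.ordConnected_univ
    have h2 : homSobolevZero (abs_half_sub_lt hH) ⊤ = Set.univ :=
      (denseRange_testLin (abs_half_sub_lt hH)).closure_range
    rw [h2, Set.image_univ, Opens.coe_top] at h1
    exact SetLike.coe_injective h1
  let J : hX.incrementSpace Set.univ ≃ₗᵢ[ℝ] HomSobolev (1 / 2 - H) :=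
    (L.equivRange.trans (LinearIsometryEquiv.ofEq _ _ hrange)).symm
  have hJ : ∀ w, (J.symm w : Lp ℝ 2 P) = L w := fun w => rfl
  have hmem : ∀ φ : 𝓓((⊤ : Opens ℝ), ℝ), hX.integralDeriv φ ∈ hX.incrementSpace Set.univ :=
    fun φ => hX.integralDeriv_mem_incrementSpace hH.1 φ
  refine ⟨J, fun φ => ⟨hmem φ, ?_⟩, fun I hI => ?_⟩
  · rw [← J.symm.injective.eq_iff, J.symm_apply_apply]
    apply Subtype.ext
    rw [hJ, map_smul, hL, smul_inv_smul₀ ha.ne']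
  · ext w
    constructor
    · rintro ⟨Z, hZ, rfl⟩
      have hZ' : (Z : Lp ℝ 2 P) ∈ (hX.incrementSpace I : Set (Lp ℝ 2 P)) := hZ
      rw [← himage I hI] at hZ'
      obtain ⟨w, hw, hwZ⟩ := hZ'
      have : J.symm w = Z := Subtype.ext hwZ
      rwa [← this, J.apply_symm_apply]
    · intro hw
      refine ⟨J.symm w, ?_, J.apply_symm_apply w⟩
      have : L w ∈ L '' homSobolevZero (abs_half_sub_lt hH) I := ⟨w, hw, rfl⟩
      rw [himage I hI] at this
      exact this
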